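/- All CAT(0) spaces are assumed nonempty and complete. For a CAT(0) space $Y$ and $p\in Y$, let $S_pY$ be the metric completion of the set of nontrivial geodesics starting from $p$, modulo the relation of making angle zero, with the Alexandrov angle $\angle_p$ as distance; the tangent cone $TC_pY$ is the Euclidean cone over $S_pY$, i.e. $(S_pY\times[0,\infty))/(S_pY\times\{0\})$ with $d((u,t),(u',t'))^2=t^2+t'^2-2tt'\cos\angle_p(u,u')$ (a single point if $S_pY=\emptyset$). For a finite connected simple graph $G=(V,E)$ put $\nu_G(u)=\deg(u)/2|E|$, and $\mu_G(u,v)=1/\deg(u)$ if $\{u,v\}\in E$, $\mu_G(u,v)=0$ otherwise. For a CAT(0) space $T$, the Wang invariant is $$\lambda_1(G,T)=\inf_\varphi \frac{\frac12\sum_{u\in V}\nu_G(u)\sum_{v\in V}\mu_G(u,v)\,d_T(\varphi(u),\varphi(v))^2}{\sum_{u\in V}\nu_G(u)\,d_T(\varphi(u),\mathrm{bar}(\varphi_*\nu_G))^2},$$ where $\varphi$ runs over all nonconstant maps $V\to T$ (with $\inf\emptyset=+\infty$) and $\mathrm{bar}(\varphi_*\nu_G)$ is the barycenter, the point $q\in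 T$ that minimizes $\sum_{u}\nu_G(u)\,d_T(\varphi(u),q)^2$. Let $F_k$ be the free group on $s_1,\dots,s_k$ and $S=\{s_1^{\pm1},\dots,s_k^{\pm1}\}$. An $S$-labelling of $G$ is a map $\alpha$ from the set of directed edges of $G$ to $S$ with $\alpha((u,v))=\alpha((v,u))^{-1}$; the label of a path is the product in $F_k$ of the labels of its successive edges, and $\Gamma_\alpha$ is the quotient of $F_k$ by the normal closure of the set of labels of all closed paths of $G$. The (finite) set of $S$-labellings of $G$ carries the uniform probability. A group $\Gamma$ has the fixed-point property for a family $\mathcal Y$ of metric spaces if for every $Y\in\mathcal Y$ and every homomorphism $\rho\colon\Gamma\to\mathrm{Isom}(Y)$ there is a point of $Y$ fixed by $\rho(\Gamma)$. **Theorem.** Given positive integers $k,d_0$ and a positive real number $\lambda_0$, there exist a positive integer $g_0=g_0(\lambda_0)$ depending only on $\lambda_0$, and constants $a_1=a_1(k,\lambda_0)>0$ and $a_2=a_2(k,d_0,\lambda_0)>0$, with the following property. If $G=(V,E)$ is a finite connected graph and $\mathcal Y$ is a family of CAT(0) spaces such that 1. $2\le\deg(u)\le d_0$ for all $u\in V$,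 2. $\mathrm{girth}(G)\ge g_0$, where the girth is the minimal length of a cycle in $G$ (without repeated vertices), 3. $\lambda_1(G,TC_pY)\ge\lambda_0$ for all $Y\in\mathcal Y$ and all $p\in Y$, then with probability at least $1-a_1e^{-a_2|V|}$ the group $\Gamma_\alpha$ has the fixed-point property for $\mathcal Y$. -/

import Mathlib

open Filter Topology Set
open scoped ENNReal

noncomputable section

namespace GraphModel

/-! ### Complete CAT(0) spaces -/

section CAT0

/-- `c` restricted to `[0, l]` is a unit speed geodesic from `p` to `q`
(its values outside `[0, l]` are irrelevant). -/
structure IsGeodesic {Y : Type*} [MetricSpace Y] (c : ℝ → Y) (l : ℝ) (p q : Y) : Prop where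
  nonneg : 0 ≤ l
  source : c 0 = p
  target : c l = q
  isom : ∀ s ∈ Icc 0 l, ∀ t ∈ Icc 0 l, dist (c s) (c t) = |s - t|

/-- A geodesic metric space all of whose geodesic triangles are at least as thin as their
comparison triangles in the Euclidean plane. The triangle has vertices `p 0, p 1, p 2`, the side
number `i` joins `p i` to `p (i + 1)` (indices mod 3), and `p'` is a comparison triangle. -/
structure IsCAT0 (Y : Type*) [MetricSpace Y] : Prop where
  exists_geodesic : ∀ p q : Y, ∃ (c : ℝ → Y) (l : ℝ), IsGeodesic c l p q
  thin : ∀ (p : Fin 3 → Y) (c : Fin 3 → ℝ → Y) (l : Fin 3 → ℝ),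
    (∀ i, IsGeodesic (c i) (l i) (p i) (p (i + 1))) →
    ∀ p' : Fin 3 → EuclideanSpace ℝ (Fin 2), (∀ i j, dist (p' i) (p' j) = dist (p i) (p j)) →
    ∀ i j : Fin 3, ∀ s ∈ Icc 0 (l i), ∀ t ∈ Icc 0 (l j),
    ∀ x ∈ segment ℝ (p' i) (p' (i + 1)), ∀ y ∈ segment ℝ (p' j) (p' (j + 1)),
      dist (p' i) x = dist (p i) (c i s) → dist (p' j) y = dist (p j) (c j t) →
      dist (c i s) (c j t) ≤ dist x y

/-- Every isometric action of `Γ` on `Y` has a global fixed point. -/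
def HasFixedPointProperty (Γ : Type*) [Group Γ] (Y : Type*) [MetricSpace Y] : Prop :=
  ∀ ρ : Γ →* (Y ≃ᵢ Y), ∃ y : Y, ∀ g : Γ, ρ g y = y

end CAT0

/-! ### The law of cosines -/

section LawOfCosines

/-- The third side of a Euclidean triangle with sides `r`, `s` enclosing the angle `θ`. -/
def thirdSide (r s θ : ℝ) : ℝ := Real.sqrt (r ^ 2 + s ^ 2 - 2 * r * s * Real.cos θ)

theorem thirdSide_eq_norm (r s a b : ℝ) :
    thirdSide r s (a - b) =
      ‖(r : ℂ) * (Real.cos a + Real.sin a * Complex.I) -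
        (s : ℂ) * (Real.cos b + Real.sin b * Complex.I)‖ := by
  rw [thirdSide, Complex.norm_eq_sqrt_sq_add_sq]
  congr 1
  simp only [Complex.sub_re, Complex.mul_re, Complex.add_re, Complex.ofReal_re, Complex.I_re,
    Complex.ofReal_im, Complex.I_im, Complex.sub_im, Complex.mul_im, Complex.add_im]
  rw [Real.cos_sub]
  linear_combination (-r ^ 2) * Real.sin_sq_add_cos_sq a - s ^ 2 * Real.sin_sq_add_cos_sq b

theorem thirdSide_comm (r s θ : ℝ) : thirdSide r s θ = thirdSide s r θ := by
  unfold thirdSide; congr 1; ring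

theorem thirdSide_nonneg (r s θ : ℝ) : 0 ≤ thirdSide r s θ := Real.sqrt_nonneg _

theorem thirdSide_arg_nonneg (r s θ : ℝ) : 0 ≤ r ^ 2 + s ^ 2 - 2 * r * s * Real.cos θ := by
  nlinarith [sq_nonneg (r - s * Real.cos θ), Real.sin_sq_add_cos_sq θ,
    mul_nonneg (sq_nonneg s) (sq_nonneg (Real.sin θ))]

theorem thirdSide_sq (r s θ : ℝ) :
    thirdSide r s θ ^ 2 = r ^ 2 + s ^ 2 - 2 * r * s * Real.cos θ :=
  Real.sq_sqrt (thirdSide_arg_nonneg r s θ)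

theorem thirdSide_mono {r s θ θ' : ℝ} (hr : 0 ≤ r) (hs : 0 ≤ s) (h0 : 0 ≤ θ) (h : θ ≤ θ')
    (hπ : θ' ≤ Real.pi) : thirdSide r s θ ≤ thirdSide r s θ' := by
  apply Real.sqrt_le_sqrt
  have := Real.cos_le_cos_of_nonneg_of_le_pi h0 hπ h
  nlinarith [mul_nonneg hr hs]

theorem thirdSide_strictMono {r s θ θ' : ℝ} (hr : 0 < r) (hs : 0 < s) (h0 : 0 ≤ θ) (h : θ < θ')
    (hπ : θ' ≤ Real.pi) : thirdSide r s θ < thirdSide r s θ' := by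
  apply Real.sqrt_lt_sqrt (thirdSide_arg_nonneg r s θ)
  have := Real.cos_lt_cos_of_nonneg_of_le_pi h0 hπ h
  nlinarith [mul_pos hr hs]

theorem thirdSide_le_add {r s : ℝ} (hr : 0 ≤ r) (hs : 0 ≤ s) (θ : ℝ) :
    thirdSide r s θ ≤ r + s := by
  apply Real.sqrt_le_iff.2 ⟨by positivity, ?_⟩
  nlinarith [Real.neg_one_le_cos θ, mul_nonneg hr hs]

theorem le_add_thirdSide {r s : ℝ} (hr : 0 ≤ r) (hs : 0 ≤ s) (θ : ℝ) :
    r ≤ s + thirdSide r s θ := by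
  have : r - s ≤ thirdSide r s θ := by
    apply Real.le_sqrt_of_sq_le
    nlinarith [Real.cos_le_one θ, mul_nonneg hr hs]
  linarith

theorem thirdSide_triangle_planar (r s t a b : ℝ) :
    thirdSide r t (a + b) ≤ thirdSide r s a + thirdSide s t b := by
  have h1 := thirdSide_eq_norm r t a (-b)
  have h2 := thirdSide_eq_norm r s a 0
  have h3 := thirdSide_eq_norm s t 0 (-b)
  rw [sub_neg_eq_add] at h1
  rw [sub_zero] at h2
  rw [zero_sub, neg_neg] at h3
  rw [h1, h2, h3]
  exact norm_sub_le_norm_sub_add_norm_sub _ _ _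

theorem thirdSide_triangle {r s t a b c : ℝ} (hr : 0 ≤ r) (hs : 0 ≤ s) (ht : 0 ≤ t)
    (hc : 0 ≤ c) (haπ : a ≤ Real.pi) (hbπ : b ≤ Real.pi)
    (hcπ : c ≤ Real.pi) (h : c ≤ a + b) :
    thirdSide r t c ≤ thirdSide r s a + thirdSide s t b := by
  rcases le_total b (Real.pi - a) with hab | hab
  · exact (thirdSide_mono hr ht hc h (by linarith)).trans (thirdSide_triangle_planar r s t a b)
  · have h1 := thirdSide_mono (r := s) (s := t) hs ht (by linarith) hab hbπ
    have h2 := thirdSide_triangle_planar r s t a (Real.pi - a)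
    have h3 := thirdSide_mono (r := r) (s := t) hr ht hc (θ' := a + (Real.pi - a)) (by linarith)
      (by linarith)
    linarith

/-- Cutting a Euclidean triangle along a ray from a vertex. -/
theorem exists_thirdSide_split {r t a b : ℝ} (hr : 0 < r) (ht : 0 < t) (ha : 0 < a) (hb : 0 < b)
    (hab : a + b < Real.pi) :
    ∃ s, 0 < s ∧ s ≤ max r t ∧ thirdSide r s a + thirdSide s t b = thirdSide r t (a + b) := by
  have hsa : 0 < Real.sin a := Real.sin_pos_of_pos_of_lt_pi ha (by linarith)
  have hsb : 0 < Real.sin b := Real.sin_pos_of_pos_of_lt_pi hb (by linarith)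
  have hsab : 0 < Real.sin (a + b) := Real.sin_pos_of_pos_of_lt_pi (by linarith) hab
  set D := r * Real.sin a + t * Real.sin b with hD
  have hDpos : 0 < D := by positivity
  set s := r * t * Real.sin (a + b) / D with hs
  have hspos : 0 < s := by positivity
  set w := r * Real.sin a / D with hw
  have hw0 : 0 ≤ w := by positivity
  have hw1 : 0 ≤ 1 - w := by
    rw [hw, sub_nonneg, div_le_one hDpos, hD]
    nlinarith [mul_pos ht hsb]
  set x : ℂ := (r : ℂ) * (Real.cos a + Real.sin a * Complex.I) with hx
  set z : ℂ := (t : ℂ) * (Real.cos (-b) + Real.sin (-b) * Complex.I) with hz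
  set y : ℂ := (s : ℂ) * (Real.cos 0 + Real.sin 0 * Complex.I) with hy
  have hyxz : y = ((1 - w : ℝ) : ℂ) * x + (w : ℂ) * z := by
    apply Complex.ext
    · simp [hx, hy, hz, -Complex.ofReal_cos, -Complex.ofReal_sin]
      rw [hs, hw, Real.sin_add]
      field_simp
      rw [hD]; ring
    · simp [hx, hy, hz, -Complex.ofReal_cos, -Complex.ofReal_sin]
      rw [hw]
      field_simp
      rw [hD]; ring
  have hnx : ‖x‖ = r := by
    have := thirdSide_eq_norm r 0 a 0
    simp only [Complex.ofReal_zero, zero_mul, sub_zero] at this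
    rw [hx, ← this, thirdSide]
    simp [hr.le]
  have hnz : ‖z‖ = t := by
    have := thirdSide_eq_norm t 0 (-b) 0
    simp only [Complex.ofReal_zero, zero_mul, sub_zero] at this
    rw [hz, ← this, thirdSide]
    simp [ht.le]
  have hny : ‖y‖ = s := by
    simp [hy, abs_of_pos hspos]
  refine ⟨s, hspos, ?_, ?_⟩
  · rw [← hny, hyxz]
    refine (norm_add_le _ _).trans ?_
    rw [norm_mul _ x, norm_mul _ z, Complex.norm_real, Complex.norm_real, hnx, hnz,
      Real.norm_of_nonneg hw0, Real.norm_of_nonneg hw1]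
    nlinarith [mul_le_mul_of_nonneg_left (le_max_left r t) hw1,
      mul_le_mul_of_nonneg_left (le_max_right r t) hw0]
  · have h1 := thirdSide_eq_norm r t a (-b)
    have h2 := thirdSide_eq_norm r s a 0
    have h3 := thirdSide_eq_norm s t 0 (-b)
    rw [sub_neg_eq_add] at h1
    rw [sub_zero] at h2
    rw [zero_sub, neg_neg] at h3
    rw [h1, h2, h3, ← hx, ← hy, ← hz]
    have e1 : x - y = (w : ℂ) * (x - z) := by rw [hyxz]; push_cast; ring
    have e2 : y - z = ((1 - w : ℝ) : ℂ) * (x - z) := by rw [hyxz]; push_cast; ring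
    rw [e1, e2, norm_mul, norm_mul, Complex.norm_real, Complex.norm_real,
      Real.norm_of_nonneg hw0, Real.norm_of_nonneg hw1]
    ring

end LawOfCosines

/-! ### Angles, directions and tangent cones -/

section Angle

variable {Y : Type*} [MetricSpace Y]

/-- The angle at the vertex corresponding to `p` in a Euclidean comparison triangle of
`p, x, y`, where `x ≠ p ≠ y`. -/
def comparisonAngle (p x y : Y) : ℝ :=
  Real.arccos ((dist p x ^ 2 + dist p y ^ 2 - dist x y ^ 2) / (2 * dist p x * dist p y))

theorem comparisonAngle_nonneg (p x y : Y) : 0 ≤ comparisonAngle p x y := Real.arccos_nonneg _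

theorem comparisonAngle_le_pi (p x y : Y) : comparisonAngle p x y ≤ Real.pi :=
  Real.arccos_le_pi _

theorem comparisonAngle_comm (p x y : Y) : comparisonAngle p x y = comparisonAngle p y x := by
  unfold comparisonAngle
  rw [dist_comm x y]
  congr 1
  ring

theorem dist_eq_thirdSide {p x y : Y} (hx : 0 < dist p x) (hy : 0 < dist p y) :
    dist x y = thirdSide (dist p x) (dist p y) (comparisonAngle p x y) := by
  have h1 : dist x y ≤ dist p x + dist p y := by
    rw [dist_comm p x]; exact dist_triangle x p y
  have h2 : dist p x ≤ dist p y + dist x y := by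
    rw [dist_comm x y]; exact dist_triangle p y x
  have h3 : dist p y ≤ dist p x + dist x y := dist_triangle p x y
  have hpos : 0 < 2 * dist p x * dist p y := by positivity
  have h0 : 0 ≤ dist x y := dist_nonneg
  rw [thirdSide, comparisonAngle, Real.cos_arccos, mul_div_cancel₀ _ hpos.ne']
  · rw [sub_sub_cancel, Real.sqrt_sq h0]
  · rw [le_div_iff₀ hpos]
    nlinarith
  · rw [div_le_iff₀ hpos]
    nlinarith

/-- A nontrivial unit speed geodesic starting from `p`. -/
structure GeodesicFrom (p : Y) where
  toFun : ℝ → Y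
  length : ℝ
  length_pos : 0 < length
  isGeodesic : IsGeodesic toFun length p (toFun length)

/-- The angle at `p` between two geodesics starting from `p`: the (upper) limit of the comparison
angles of `p, c(s), c'(t)` as `s, t → 0`. (In a CAT(0) space the limit exists.) -/
def angle {p : Y} (c c' : GeodesicFrom p) : ℝ :=
  limsup (fun z : ℝ × ℝ => comparisonAngle p (c.toFun z.1) (c'.toFun z.2))
    (𝓝[>] (0 : ℝ) ×ˢ 𝓝[>] (0 : ℝ))

theorem GeodesicFrom.dist_base {p : Y} (c : GeodesicFrom p) {s : ℝ} (h0 : 0 < s)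
    (h1 : s < c.length) : dist p (c.toFun s) = s := by
  have h := c.isGeodesic.isom 0 ⟨le_rfl, c.length_pos.le⟩ s ⟨h0.le, h1.le⟩
  rw [c.isGeodesic.source, zero_sub, abs_neg, abs_of_pos h0] at h
  exact h

theorem isBoundedUnder_comparisonAngle {p : Y} (c c' : GeodesicFrom p) (F : Filter (ℝ × ℝ)) :
    F.IsBoundedUnder (· ≤ ·)
      (fun z : ℝ × ℝ => comparisonAngle p (c.toFun z.1) (c'.toFun z.2)) :=
  isBoundedUnder_of ⟨Real.pi, fun _ => comparisonAngle_le_pi _ _ _⟩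

theorem isCoboundedUnder_comparisonAngle {p : Y} (c c' : GeodesicFrom p) (F : Filter (ℝ × ℝ))
    [F.NeBot] : F.IsCoboundedUnder (· ≤ ·)
      (fun z : ℝ × ℝ => comparisonAngle p (c.toFun z.1) (c'.toFun z.2)) :=
  (isBoundedUnder_of ⟨0, fun _ => comparisonAngle_nonneg _ _ _⟩ :
    F.IsBoundedUnder (· ≥ ·) _).isCoboundedUnder_le

theorem angle_nonneg {p : Y} (c c' : GeodesicFrom p) : 0 ≤ angle c c' :=
  le_limsup_of_frequently_le
    (Eventually.frequently (Eventually.of_forall fun _ => comparisonAngle_nonneg _ _ _))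
    (isBoundedUnder_comparisonAngle c c' _)

theorem angle_le_pi {p : Y} (c c' : GeodesicFrom p) : angle c c' ≤ Real.pi :=
  limsup_le_of_le (isCoboundedUnder_comparisonAngle c c' _)
    (Eventually.of_forall fun _ => comparisonAngle_le_pi _ _ _)

theorem angle_self {p : Y} (c : GeodesicFrom p) : angle c c = 0 := by
  have hev : ∀ᶠ s in 𝓝[>] (0 : ℝ), 0 < s ∧ s < c.length :=
    Ioo_mem_nhdsGT c.length_pos
  have : (fun z : ℝ × ℝ => comparisonAngle p (c.toFun z.1) (c.toFun z.2))
      =ᶠ[𝓝[>] (0 : ℝ) ×ˢ 𝓝[>] (0 : ℝ)] fun _ => (0 : ℝ) := by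
    filter_upwards [hev.prod_mk hev] with z hz
    obtain ⟨⟨h1, h2⟩, h3, h4⟩ := hz
    unfold comparisonAngle
    rw [c.dist_base h1 h2, c.dist_base h3 h4,
      c.isGeodesic.isom z.1 ⟨h1.le, h2.le⟩ z.2 ⟨h3.le, h4.le⟩, sq_abs]
    have : z.1 ^ 2 + z.2 ^ 2 - (z.1 - z.2) ^ 2 = 2 * z.1 * z.2 := by ring
    rw [this, div_self (by positivity), Real.arccos_one]
  rw [angle, limsup_congr this, limsup_const]

theorem angle_comm {p : Y} (c c' : GeodesicFrom p) : angle c c' = angle c' c := by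
  unfold angle
  conv_rhs => rw [Filter.prod_comm]
  rw [← Filter.limsup_comp]
  refine limsup_congr (Eventually.of_forall fun z => ?_)
  exact comparisonAngle_comm _ _ _

theorem angle_triangle {p : Y} (c₁ c₂ c₃ : GeodesicFrom p) :
    angle c₁ c₃ ≤ angle c₁ c₂ + angle c₂ c₃ := by
  by_contra! hlt
  set δ := (angle c₁ c₃ - (angle c₁ c₂ + angle c₂ c₃)) / 3 with hδ
  have hδ0 : 0 < δ := by linarith
  have e12 := eventually_lt_of_limsup_lt (show angle c₁ c₂ < angle c₁ c₂ + δ by linarith)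
    (isBoundedUnder_comparisonAngle c₁ c₂ _)
  have e23 := eventually_lt_of_limsup_lt (show angle c₂ c₃ < angle c₂ c₃ + δ by linarith)
    (isBoundedUnder_comparisonAngle c₂ c₃ _)
  have f13 := frequently_lt_of_lt_limsup (isCoboundedUnder_comparisonAngle c₁ c₃ _)
    (show angle c₁ c₃ - δ < angle c₁ c₃ by linarith)
  have hbasis := (nhdsGT_basis (0 : ℝ)).prod_self
  obtain ⟨ε₁, hε₁, h12⟩ := hbasis.eventually_iff.1 e12
  obtain ⟨ε₂, hε₂, h23⟩ := hbasis.eventually_iff.1 e23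
  set ε := min (min ε₁ ε₂) (min c₁.length (min c₂.length c₃.length)) with hε
  have hε0 : 0 < ε := lt_min (lt_min hε₁ hε₂)
    (lt_min c₁.length_pos (lt_min c₂.length_pos c₃.length_pos))
  have hev : ∀ᶠ s in 𝓝[>] (0 : ℝ), 0 < s ∧ s < ε := Ioo_mem_nhdsGT hε0
  obtain ⟨⟨r, t⟩, h13, ⟨hr0, hrε⟩, ht0, htε⟩ := (f13.and_eventually (hev.prod_mk hev)).exists
  simp only at h13 hr0 hrε ht0 htε
  have ha := angle_nonneg c₁ c₂
  have hb := angle_nonneg c₂ c₃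
  have hsum : angle c₁ c₂ + δ + (angle c₂ c₃ + δ) = angle c₁ c₃ - δ := by linarith
  have hπ := comparisonAngle_le_pi p (c₁.toFun r) (c₃.toFun t)
  obtain ⟨s, hs0, hsm, hs⟩ := exists_thirdSide_split hr0 ht0
    (show 0 < angle c₁ c₂ + δ by linarith) (show 0 < angle c₂ c₃ + δ by linarith)
    (by linarith)
  have hsε : s < ε := lt_of_le_of_lt hsm (max_lt hrε htε)
  have b1 : ε ≤ ε₁ := (min_le_left _ _).trans (min_le_left _ _)
  have b2 : ε ≤ ε₂ := (min_le_left _ _).trans (min_le_right _ _)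
  have l1 : ε ≤ c₁.length := (min_le_right _ _).trans (min_le_left _ _)
  have l2 : ε ≤ c₂.length := (min_le_right _ _).trans ((min_le_right _ _).trans (min_le_left _ _))
  have l3 : ε ≤ c₃.length :=
    (min_le_right _ _).trans ((min_le_right _ _).trans (min_le_right _ _))
  have g12 := @h12 (r, s) ⟨⟨hr0, by linarith⟩, hs0, by linarith⟩
  have g23 := @h23 (s, t) ⟨⟨hs0, by linarith⟩, ht0, by linarith⟩
  simp only at g12 g23
  have d1 := c₁.dist_base hr0 (hrε.trans_le l1)
  have d2 := c₂.dist_base hs0 (hsε.trans_le l2)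
  have d3 := c₃.dist_base ht0 (htε.trans_le l3)
  have D12 := dist_eq_thirdSide (p := p) (x := c₁.toFun r) (y := c₂.toFun s)
    (by rwa [d1]) (by rwa [d2])
  have D23 := dist_eq_thirdSide (p := p) (x := c₂.toFun s) (y := c₃.toFun t)
    (by rwa [d2]) (by rwa [d3])
  have D13 := dist_eq_thirdSide (p := p) (x := c₁.toFun r) (y := c₃.toFun t)
    (by rwa [d1]) (by rwa [d3])
  rw [d1, d2] at D12
  rw [d2, d3] at D23
  rw [d1, d3] at D13
  have i12 := thirdSide_strictMono hr0 hs0 (comparisonAngle_nonneg _ _ _) g12 (by linarith)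
  have i23 := thirdSide_strictMono hs0 ht0 (comparisonAngle_nonneg _ _ _) g23 (by linarith)
  have i13 := thirdSide_strictMono (θ := angle c₁ c₂ + δ + (angle c₂ c₃ + δ)) hr0 ht0
    (by linarith) (by rw [hsum]; exact h13) hπ
  have tri := dist_triangle (c₁.toFun r) (c₂.toFun s) (c₃.toFun t)
  linarith

/-- The angle is a pseudo-distance on the set of nontrivial geodesics starting from `p`. -/
instance (p : Y) : PseudoMetricSpace (GeodesicFrom p) where
  dist := angle
  dist_self := angle_self
  dist_comm := angle_comm
  dist_triangle := angle_triangle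

/-- The space of directions `S_pY`: the metric completion of the set of nontrivial geodesics
starting from `p`, with geodesics at angle zero identified. -/
abbrev SpaceOfDirections (p : Y) : Type _ := UniformSpace.Completion (GeodesicFrom p)

end Angle

section Cone

/-- The Euclidean cone `(S × [0, ∞)) / (S × {0})`: the apex and the pairs `(u, t)` with `t > 0`.
(The cone over the empty set is a single point.) -/
inductive EuclideanCone (S : Type*) where
  | apex : EuclideanCone S
  | point (u : S) (t : ℝ) (ht : 0 < t) : EuclideanCone S

variable {S : Type*} [MetricSpace S]

/-- `d((u,t),(u',t'))² = t² + t'² - 2tt' cos (min (d(u,u'), π))`. -/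
def EuclideanCone.cdist : EuclideanCone S → EuclideanCone S → ℝ
  | .apex, .apex => 0
  | .apex, .point _ t _ => t
  | .point _ t _, .apex => t
  | .point u t _, .point u' t' _ => thirdSide t t' (min (dist u u') Real.pi)

instance : MetricSpace (EuclideanCone S) where
  dist := EuclideanCone.cdist
  dist_self x := by
    cases x with
    | apex => rfl
    | point u t ht =>
      change thirdSide t t (min (dist u u) Real.pi) = 0
      rw [dist_self, min_eq_left Real.pi_pos.le, thirdSide, Real.cos_zero]
      ring_nf
      exact Real.sqrt_zero
  dist_comm x y := by
    cases x <;> cases y <;> try rfl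
    change thirdSide _ _ _ = thirdSide _ _ _
    rw [thirdSide_comm, dist_comm]
  dist_triangle x y z := by
    cases x with
    | apex =>
      cases y with
      | apex => cases z <;> simp [EuclideanCone.cdist]
      | point v s hs =>
        cases z with
        | apex => simp only [EuclideanCone.cdist]; linarith
        | point w t ht =>
          simp only [EuclideanCone.cdist]
          rw [thirdSide_comm]
          exact le_add_thirdSide ht.le hs.le _
    | point u r hr =>
      cases y with
      | apex =>
        cases z with
        | apex => simp [EuclideanCone.cdist]
        | point w t ht => exact thirdSide_le_add hr.le ht.le _
      | point v s hs =>
        cases z with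
        | apex =>
          simp only [EuclideanCone.cdist]
          rw [add_comm]
          exact le_add_thirdSide hr.le hs.le _
        | point w t ht =>
          have hπ := Real.pi_pos.le
          refine thirdSide_triangle hr.le hs.le ht.le (le_min dist_nonneg hπ) (min_le_right _ _)
            (min_le_right _ _) (min_le_right _ _) ?_
          have h := dist_triangle u v w
          have h1 : 0 ≤ dist u v := dist_nonneg
          have h2 : 0 ≤ dist v w := dist_nonneg
          rcases le_total (dist u v) Real.pi with h3 | h3 <;>
            rcases le_total (dist v w) Real.pi with h4 | h4 <;>
            simp only [min_eq_left, min_eq_right, h3, h4] <;>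
            first
            | exact (min_le_left _ _).trans h
            | exact (min_le_right _ _).trans (by linarith)
  eq_of_dist_eq_zero := by
    intro x y h
    cases x with
    | apex =>
      cases y with
      | apex => rfl
      | point v s hs => exact absurd h hs.ne'
    | point u r hr =>
      cases y with
      | apex => exact absurd h hr.ne'
      | point v s hs =>
        replace h : thirdSide r s (min (dist u v) Real.pi) = 0 := h
        have h2 := thirdSide_sq r s (min (dist u v) Real.pi)
        rw [h] at h2
        have hle := Real.cos_le_one (min (dist u v) Real.pi)
        have hrs := mul_pos hr hs
        have hcos : Real.cos (min (dist u v) Real.pi) = 1 := by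
          nlinarith [sq_nonneg (r - s)]
        have hreq : r = s := by
          rw [hcos] at h2
          have : (r - s) ^ 2 = 0 := by linarith
          exact sub_eq_zero.1 (pow_eq_zero_iff two_ne_zero |>.1 this)
        have hmin : min (dist u v) Real.pi = 0 := by
          refine (Real.injOn_cos ⟨le_min dist_nonneg Real.pi_pos.le, min_le_right _ _⟩
            ⟨le_rfl, Real.pi_pos.le⟩ ?_)
          rw [hcos, Real.cos_zero]
        have hd : dist u v = 0 := by
          rcases min_choice (dist u v) Real.pi with h5 | h5
          · rwa [h5] at hmin
          · rw [h5] at hmin; exact absurd hmin Real.pi_pos.ne'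
        obtain rfl := eq_of_dist_eq_zero hd
        subst hreq
        rfl

end Cone

/-- The tangent cone `TC_pY`: the Euclidean cone over the space of directions at `p`. -/
abbrev TangentCone {Y : Type*} [MetricSpace Y] (p : Y) : Type _ :=
  EuclideanCone (SpaceOfDirections p)

/-! ### The Wang invariant -/

section Wang

variable {V : Type*} [Fintype V] (G : SimpleGraph V) [DecidableRel G.Adj]

/-- The transition probabilities of the standard random walk on `G`. -/
def randomWalk (u v : V) : ℝ := if G.Adj u v then 1 / (G.degree u : ℝ) else 0

/-- The standard probability measure on `V`: `u` has mass `deg(u) / 2|E|`. -/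
def vertexMeasure (u : V) : ℝ := (G.degree u : ℝ) / (2 * (G.edgeSet.ncard : ℝ))

/-- `b` is a barycenter of the push-forward under `φ` of the measure with weights `w`: it minimizes
the weighted sum of the squared distances. -/
def IsBarycenter {V : Type*} [Fintype V] {T : Type*} [MetricSpace T]
    (w : V → ℝ) (φ : V → T) (b : T) : Prop :=
  ∀ q : T, ∑ u, w u * dist (φ u) b ^ 2 ≤ ∑ u, w u * dist (φ u) q ^ 2

/-- The Rayleigh quotient of `φ`, where `b` is the barycenter of the image measure. -/
def rayleighQuotient {T : Type*} [MetricSpace T] (φ : V → T) (b : T) : ℝ :=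
  ((1 / 2) * ∑ u, vertexMeasure G u * ∑ v, randomWalk G u v * dist (φ u) (φ v) ^ 2) /
    ∑ u, vertexMeasure G u * dist (φ u) b ^ 2

/-- The Wang invariant `λ₁(G, T)`: the infimum of the Rayleigh quotients of all nonconstant maps
`φ : V → T`. It is `∞` if there is no such map. -/
def wangInvariant (T : Type*) [MetricSpace T] : ℝ≥0∞ :=
  ⨅ (φ : V → T) (_ : ∃ u v, φ u ≠ φ v) (b : T) (_ : IsBarycenter (vertexMeasure G) φ b),
    ENNReal.ofReal (rayleighQuotient G φ b)

end Wang

/-! ### The graph model of random groups -/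

section RandomGroup

variable {V : Type*} (G : SimpleGraph V) (k : ℕ)

/-- The labellings of the directed edges of `G` by the letters `s₁^±, …, s_k^±`, such that opposite
edges have inverse labels. The letter `(i, true)` is `s_i`, the letter `(i, false)` is `s_i⁻¹`. -/
def Labelling : Type _ :=
  {α : G.Dart → Fin k × Bool // ∀ e : G.Dart, α e.symm = ((α e).1, !(α e).2)}

variable {G k}

/-- The element of the free group obtained by multiplying the labels along a path. -/
def Labelling.word (α : Labelling G k) {u v : V} (c : G.Walk u v) : FreeGroup (Fin k) :=
  (c.darts.map fun e => FreeGroup.mk [α.1 e]).prod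

/-- The labels of all closed paths of `G`. -/
def Labelling.relators (α : Labelling G k) : Set (FreeGroup (Fin k)) :=
  {r | ∃ (u : V) (c : G.Walk u u), r = α.word c}

/-- The quotient `Γ_α` of the free group by the normal closure of the labels of closed paths. -/
abbrev Labelling.group (α : Labelling G k) : Type := PresentedGroup α.relators

variable (G k)

/-- The probability of `P` with respect to the uniform distribution on the set of labellings. -/
def labellingProb (P : Labelling G k → Prop) : ℝ :=
  (Nat.card {α : Labelling G k // P α} : ℝ) / (Nat.card (Labelling G k) : ℝ)

end RandomGroup

end GraphModel

end

open Filter Topology Set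
open scoped ENNReal

noncomputable section

namespace GraphModel

/-! ### The inequality of Bruhat and Tits -/

section Comparison

/-! Fix `n` with `n - 1 ≥ 8 / lam` and girth larger than `n`. For an action on `Y` and a point `y`,
let `e` be the mean squared displacement of `y` under one random letter and `W n` the one under a
uniformly random word of length `n`. Two estimates of `W n` are played against each other.

Upper bound, from the graph. Closed paths act trivially, so the orbit of `y` gives a map `φ : V → Y`
for which the displacement of `y` by the label of a path is the distance between the images of its
ends (`exists_orbit_map`). The logarithm at the barycenter of `φ` does not increase distances,
preserves distances to the base point and keeps the barycenter. A bound on the Wang invariant of the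
tangent cone is therefore a Poincaré inequality in `Y` itself (`IsCAT0.poincare`): the variance of
`φ` is at most a multiple of its edge energy. Squared distances between the ends of long paths are
controlled by the variance, whatever the length. If the words read along a suitable family of paths
of length `n` are nearly equidistributed, this yields `W n ≤ (8 / lam) * e ≤ (n - 1) * e`.

Lower bound, from CAT(0) geometry. If `y` nearly is the barycenter of its translates, the variance
inequality makes each further letter add almost `e`, so `W n` exceeds `(n - 1) * e` when `e > 0`
(`IsCAT0.wordEnergy_ge`). Hence, if `e > 0`, `y` is at distance at least a definite multiple of `√e`
from that barycenter, and moving half way towards it multiplies `e` by a factor less than `1` that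
depends only on `n` (`IsCAT0.exists_letterEnergy_le`). Iteration converges geometrically to a fixed
point.

Equidistribution, from randomness. As all degrees are at least `2`, some permutation `σ` of the
directed edges continues every edge without backtracking. Below the girth, `n` successive edges are
distinct, so their labels are independent and uniform. A bounded difference inequality and a union
bound over words finish the proof (`card_not_isEquidistributed_le`). The favourable event involves
only the labelling, so it serves all spaces of the family simultaneously. -/

theorem exists_comparison_triangle {Y : Type*} [MetricSpace Y] (p : Fin 3 → Y) :
    ∃ p' : Fin 3 → EuclideanSpace ℝ (Fin 2), ∀ i j, dist (p' i) (p' j) = dist (p i) (p j) := by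
  set a := dist (p 0) (p 1) with ha
  set b := dist (p 0) (p 2) with hb
  set c := dist (p 1) (p 2) with hc
  have ha0 : 0 ≤ a := dist_nonneg
  have hb0 : 0 ≤ b := dist_nonneg
  have hc0 : 0 ≤ c := dist_nonneg
  have h1 : a ≤ b + c := by rw [ha, hb, hc, dist_comm (p 1)]; exact dist_triangle _ _ _
  have h2 : b ≤ a + c := dist_triangle _ _ _
  have h3 : c ≤ a + b := by rw [ha, hb, hc, dist_comm (p 0) (p 1)]; exact dist_triangle _ _ _
  -- Abscissa of the third vertex when the first two are `(0, 0)` and `(a, 0)`. If `a = 0`, division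
  -- by zero gives `x = 0`, and `b = c` keeps `hax` true.
  set x := (a ^ 2 + b ^ 2 - c ^ 2) / (2 * a) with hx
  have hax : 2 * a * x = a ^ 2 + b ^ 2 - c ^ 2 := by
    rcases ha0.eq_or_lt with h | h
    · have : b = c := by linarith
      simp [← h, this]
    · rw [hx]; field_simp
  have hxb : 0 ≤ b ^ 2 - x ^ 2 := by
    rcases ha0.eq_or_lt with h | h
    · simp [hx, ← h, sq_nonneg]
    · have : 0 ≤ (2 * a) ^ 2 * (b ^ 2 - x ^ 2) := by
        -- Heron's formula; both factors are nonnegative by the triangle inequalities.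
        have e : (2 * a) ^ 2 * (b ^ 2 - x ^ 2) =
            ((a + b) ^ 2 - c ^ 2) * (c ^ 2 - (a - b) ^ 2) := by
          linear_combination (-(2 * a * x) - (a ^ 2 + b ^ 2 - c ^ 2)) * hax
        rw [e]
        apply mul_nonneg <;> nlinarith
      exact nonneg_of_mul_nonneg_right this (by positivity)
  have hh := Real.sq_sqrt hxb
  refine ⟨![!₂[0, 0], !₂[a, 0], !₂[x, Real.sqrt (b ^ 2 - x ^ 2)]], ?_⟩
  set h := Real.sqrt (b ^ 2 - x ^ 2)
  have e01 : dist (!₂[0, 0] : EuclideanSpace ℝ (Fin 2)) !₂[a, 0] = a := by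
    rw [EuclideanSpace.dist_eq]; simp [Real.dist_eq, ha0]
  have e02 : dist (!₂[0, 0] : EuclideanSpace ℝ (Fin 2)) !₂[x, h] = b := by
    rw [EuclideanSpace.dist_eq]
    simp only [Fin.sum_univ_two, Real.dist_eq, sq_abs]
    simp only [Matrix.cons_val_zero, Matrix.cons_val_one]
    rw [show (0 - x) ^ 2 + (0 - h) ^ 2 = b ^ 2 by linarith, Real.sqrt_sq hb0]
  have e12 : dist (!₂[a, 0] : EuclideanSpace ℝ (Fin 2)) !₂[x, h] = c := by
    rw [EuclideanSpace.dist_eq]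
    simp only [Fin.sum_univ_two, Real.dist_eq, sq_abs]
    simp only [Matrix.cons_val_zero, Matrix.cons_val_one]
    rw [show (a - x) ^ 2 + (0 - h) ^ 2 = c ^ 2 by linarith, Real.sqrt_sq hc0]
  intro i j
  fin_cases i <;> fin_cases j <;> simp only [Fin.zero_eta, Fin.mk_one, Fin.reduceFinMk,
    Matrix.cons_val_zero, Matrix.cons_val_one, Matrix.cons_val, dist_self]
  · exact e01
  · exact e02
  · rw [dist_comm, e01, dist_comm (p 1)]
  · exact e12
  · rw [dist_comm, e02, dist_comm (p 2)]
  · rw [dist_comm, e12, dist_comm (p 2)]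

/-- Stewart's theorem, the Euclidean equality behind the Bruhat–Tits inequality. -/
theorem dist_sq_lineMap {E : Type*} [NormedAddCommGroup E] [InnerProductSpace ℝ E] (x y z : E)
    (t : ℝ) : dist z (AffineMap.lineMap x y t) ^ 2 =
      (1 - t) * dist z x ^ 2 + t * dist z y ^ 2 - t * (1 - t) * dist x y ^ 2 := by
  have e1 : z - AffineMap.lineMap x y t = (z - x) - t • (y - x) := by
    simp [AffineMap.lineMap_apply]; abel
  have e2 : z - y = (z - x) - (y - x) := by abel
  rw [dist_eq_norm, dist_eq_norm, dist_eq_norm, dist_eq_norm, e1, norm_sub_rev x y, e2,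
    norm_sub_sq_real (z - x), norm_sub_sq_real (z - x), inner_smul_right, norm_smul, mul_pow, Real.norm_eq_abs,
    sq_abs]
  ring

variable {Y : Type*} [MetricSpace Y]

theorem IsGeodesic.dist_eq {c : ℝ → Y} {l : ℝ} {x y : Y} (hc : IsGeodesic c l x y) :
    dist x y = l := by
  have h := hc.isom 0 ⟨le_rfl, hc.nonneg⟩ l ⟨hc.nonneg, le_rfl⟩
  rwa [hc.source, hc.target, zero_sub, abs_neg, abs_of_nonneg hc.nonneg] at h

theorem IsGeodesic.dist_source {c : ℝ → Y} {l : ℝ} {x y : Y} (hc : IsGeodesic c l x y) {s : ℝ}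
    (hs : s ∈ Icc 0 l) : dist x (c s) = s := by
  have h := hc.isom 0 ⟨le_rfl, hc.nonneg⟩ s hs
  rwa [hc.source, zero_sub, abs_neg, abs_of_nonneg hs.1] at h

/-- Thinness is applied to a point of one side and the opposite vertex, the latter seen as the start
of side `2`; Stewart's theorem evaluates the comparison distance. -/
theorem IsCAT0.dist_sq_le (hY : IsCAT0 Y) {c : ℝ → Y} {l : ℝ} {x y : Y}
    (hc : IsGeodesic c l x y) {t : ℝ} (ht : t ∈ Icc (0 : ℝ) 1) (z : Y) :
    dist z (c (t * l)) ^ 2 ≤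
      (1 - t) * dist z x ^ 2 + t * dist z y ^ 2 - t * (1 - t) * dist x y ^ 2 := by
  obtain ⟨c₁, l₁, h₁⟩ := hY.exists_geodesic y z
  obtain ⟨c₂, l₂, h₂⟩ := hY.exists_geodesic z x
  obtain ⟨p', hp'⟩ := exists_comparison_triangle ![x, y, z]
  have hs : t * l ∈ Icc 0 l :=
    ⟨mul_nonneg ht.1 hc.nonneg, mul_le_of_le_one_left hc.nonneg ht.2⟩
  have e01 : dist (p' 0) (p' 1) = dist x y := hp' 0 1
  have e20 : dist (p' 2) (p' 0) = dist z x := hp' 2 0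
  have e21 : dist (p' 2) (p' 1) = dist z y := hp' 2 1
  have key := hY.thin ![x, y, z] ![c, c₁, c₂] ![l, l₁, l₂]
    (by intro i; fin_cases i
        · exact hc
        · exact h₁
        · exact h₂) p' hp' 0 2 (t * l) hs 0 ⟨le_rfl, h₂.nonneg⟩
    (AffineMap.lineMap (p' 0) (p' 1) t)
    (by rw [segment_eq_image_lineMap]; exact ⟨t, ht, rfl⟩) (p' 2) (left_mem_segment ℝ _ _)
    (by
      change dist (p' 0) _ = dist x (c (t * l))
      rw [dist_left_lineMap, e01, hc.dist_eq, hc.dist_source hs, Real.norm_of_nonneg ht.1])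
    (by
      change dist (p' 2) (p' 2) = dist z (c₂ 0)
      rw [h₂.source, dist_self, dist_self])
  have key' : dist z (c (t * l)) ≤ dist (p' 2) (AffineMap.lineMap (p' 0) (p' 1) t) := by
    rw [dist_comm (p' 2), dist_comm z]
    change dist (c (t * l)) (c₂ 0) ≤ _ at key
    rwa [h₂.source] at key
  calc dist z (c (t * l)) ^ 2 ≤ dist (p' 2) (AffineMap.lineMap (p' 0) (p' 1) t) ^ 2 := by gcongr
    _ = _ := by rw [dist_sq_lineMap, e01, e20, e21]

/-- Points on geodesics in CAT(0) spaces, with the Bruhat–Tits inequality. -/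
theorem IsCAT0.exists_between (hY : IsCAT0 Y) (x y : Y) {t : ℝ} (ht : t ∈ Icc (0 : ℝ) 1) :
    ∃ m : Y, dist x m = t * dist x y ∧ ∀ z, dist z m ^ 2 ≤
      (1 - t) * dist z x ^ 2 + t * dist z y ^ 2 - t * (1 - t) * dist x y ^ 2 := by
  obtain ⟨c, l, hc⟩ := hY.exists_geodesic x y
  refine ⟨c (t * l), ?_, hY.dist_sq_le hc ht⟩
  rw [hc.dist_eq, hc.dist_source
    ⟨mul_nonneg ht.1 hc.nonneg, mul_le_of_le_one_left hc.nonneg ht.2⟩]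

/-- The Bruhat–Tits inequality at the midpoint of one diagonal, seen from both ends of the other,
combined with `(r + s)² ≤ 2 r² + 2 s²`. -/
theorem IsCAT0.quadrilateral (hY : IsCAT0 Y) (a b c d : Y) :
    dist a c ^ 2 + dist b d ^ 2 ≤
      dist a b ^ 2 + dist b c ^ 2 + dist c d ^ 2 + dist d a ^ 2 := by
  obtain ⟨m, -, hm⟩ := hY.exists_between a c (t := 1 / 2) ⟨by norm_num, by norm_num⟩
  have h1 := hm b
  have h2 := hm d
  have h3 : dist b d ≤ dist b m + dist d m := by rw [dist_comm d m]; exact dist_triangle _ _ _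
  have h4 : dist b d ^ 2 ≤ (dist b m + dist d m) ^ 2 := by gcongr
  rw [dist_comm a b, dist_comm c d]
  nlinarith [sq_nonneg (dist b m - dist d m)]

end Comparison

/-! ### Barycenters -/

section Barycenter

variable {Y : Type*} [MetricSpace Y] {V : Type*} [Fintype V]

theorem IsCAT0.exists_sum_between (hY : IsCAT0 Y) {w : V → ℝ} (hw : ∀ u, 0 ≤ w u)
    (hw1 : ∑ u, w u = 1) (φ : V → Y) (x y : Y) {t : ℝ} (ht : t ∈ Icc (0 : ℝ) 1) :
    ∃ m : Y, dist x m = t * dist x y ∧ ∑ u, w u * dist (φ u) m ^ 2 ≤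
      (1 - t) * ∑ u, w u * dist (φ u) x ^ 2 + t * ∑ u, w u * dist (φ u) y ^ 2 -
        t * (1 - t) * dist x y ^ 2 := by
  obtain ⟨m, hxm, hm⟩ := hY.exists_between x y ht
  refine ⟨m, hxm, ?_⟩
  calc ∑ u, w u * dist (φ u) m ^ 2
      ≤ ∑ u, w u * ((1 - t) * dist (φ u) x ^ 2 + t * dist (φ u) y ^ 2 -
          t * (1 - t) * dist x y ^ 2) :=
        Finset.sum_le_sum fun u _ => mul_le_mul_of_nonneg_left (hm _) (hw u)
    _ = (1 - t) * ∑ u, w u * dist (φ u) x ^ 2 + t * ∑ u, w u * dist (φ u) y ^ 2 -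
        (∑ u, w u) * (t * (1 - t) * dist x y ^ 2) := by
        rw [Finset.mul_sum, Finset.mul_sum, Finset.sum_mul, ← Finset.sum_add_distrib,
          ← Finset.sum_sub_distrib]
        exact Finset.sum_congr rfl fun u _ => by ring
    _ = _ := by rw [hw1, one_mul]

/-- The minimizer is compared with the point at parameter `t` on the way to `z`. Strong convexity
gives the inequality with the factor `1 - t` after division by `t`; then `t → 0`. -/
theorem IsCAT0.variance_le (hY : IsCAT0 Y) {w : V → ℝ} (hw : ∀ u, 0 ≤ w u)
    (hw1 : ∑ u, w u = 1) {φ : V → Y} {b : Y} (hb : IsBarycenter w φ b) (z : Y) :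
    ∑ u, w u * dist (φ u) b ^ 2 + dist b z ^ 2 ≤ ∑ u, w u * dist (φ u) z ^ 2 := by
  set A := ∑ u, w u * dist (φ u) b ^ 2
  set B := ∑ u, w u * dist (φ u) z ^ 2
  have key : ∀ t ∈ Ioo (0 : ℝ) 1, A + (1 - t) * dist b z ^ 2 ≤ B := by
    intro t ht
    obtain ⟨m, -, hm⟩ := hY.exists_sum_between hw hw1 φ b z ⟨ht.1.le, ht.2.le⟩
    have h := (hb m).trans hm
    have : 0 ≤ t * (B - (A + (1 - t) * dist b z ^ 2)) := by linarith
    linarith [nonneg_of_mul_nonneg_right this ht.1]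
  have hlim : Tendsto (fun t : ℝ => A + (1 - t) * dist b z ^ 2) (𝓝[>] 0)
      (𝓝 (A + (1 - 0) * dist b z ^ 2)) :=
    Tendsto.mono_left (Continuous.tendsto (by fun_prop) 0) nhdsWithin_le_nhds
  rw [sub_zero, one_mul] at hlim
  refine le_of_tendsto hlim ?_
  filter_upwards [Ioo_mem_nhdsGT (zero_lt_one' ℝ)] with t ht using key t ht

theorem IsCAT0.exists_isBarycenter [CompleteSpace Y] [Nonempty Y] (hY : IsCAT0 Y) {w : V → ℝ}
    (hw : ∀ u, 0 ≤ w u) (hw1 : ∑ u, w u = 1) (φ : V → Y) : ∃ b, IsBarycenter w φ b := by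
  set F : Y → ℝ := fun q => ∑ u, w u * dist (φ u) q ^ 2 with hF
  have hF0 : ∀ q, 0 ≤ F q := fun q => Finset.sum_nonneg fun u _ => mul_nonneg (hw u) (sq_nonneg _)
  have hbdd : BddBelow (range F) := ⟨0, by rintro _ ⟨q, rfl⟩; exact hF0 q⟩
  set I := ⨅ q, F q with hI
  have hle : ∀ q, I ≤ F q := fun q => ciInf_le hbdd q
  have hex : ∀ n : ℕ, ∃ q, F q < I + 1 / ((n : ℝ) + 1) := fun n =>
    exists_lt_of_ciInf_lt (by linarith [Nat.one_div_pos_of_nat (α := ℝ) (n := n)])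
  choose x hx using hex
  -- The midpoint of `q` and `r` has value at least `I`, so strong convexity forces near-minimizers
  -- to be close; minimizing sequences are Cauchy.
  have hd : ∀ q r, dist q r ^ 2 ≤ 2 * (F q - I) + 2 * (F r - I) := by
    intro q r
    obtain ⟨m, -, hm⟩ := hY.exists_sum_between hw hw1 φ q r (t := 1 / 2)
      ⟨by norm_num, by norm_num⟩
    have := (hle m).trans hm
    simp only [hF] at this ⊢
    linarith
  have hcau : CauchySeq x := by
    rw [Metric.cauchySeq_iff']
    intro ε hε
    obtain ⟨N, hN⟩ := exists_nat_one_div_lt (show 0 < ε ^ 2 / 4 by positivity)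
    refine ⟨N, fun n hn => ?_⟩
    have h1 := hd (x n) (x N)
    have h2 : 1 / ((n : ℝ) + 1) ≤ 1 / ((N : ℝ) + 1) := Nat.one_div_le_one_div hn
    exact lt_of_pow_lt_pow_left₀ 2 hε.le (by linarith [hx n, hx N])
  obtain ⟨b, hb⟩ := cauchySeq_tendsto_of_complete hcau
  have hFc : Continuous F := by fun_prop
  have hFb : F b ≤ I := by
    have h1 := (hFc.tendsto b).comp hb
    have h2 : Tendsto (fun n : ℕ => I + 1 / ((n : ℝ) + 1)) atTop (𝓝 (I + 0)) :=
      tendsto_const_nhds.add tendsto_one_div_add_atTop_nhds_zero_nat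
    rw [add_zero] at h2
    exact le_of_tendsto_of_tendsto' h1 h2 fun n => (hx n).le
  exact ⟨b, fun q => hFb.trans (hle q)⟩

end Barycenter

/-! ### Random walks and a criterion for fixed points -/

section Criterion

variable {S M : Type*}

/-- The product of the elements `T s` along the word `w`. -/
def wordProd [Monoid M] (T : S → M) {m : ℕ} (w : Fin m → S) : M :=
  (List.ofFn fun i => T (w i)).prod

theorem wordProd_zero [Monoid M] (T : S → M) (w : Fin 0 → S) : wordProd T w = 1 := by
  simp [wordProd]

theorem wordProd_cons [Monoid M] (T : S → M) {m : ℕ} (s : S) (w : Fin m → S) :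
    wordProd T (Fin.cons s w : Fin (m + 1) → S) = T s * wordProd T w := by
  simp [wordProd, List.ofFn_succ]

variable [Fintype S] {Y : Type*} [MetricSpace Y]

/-- The mean squared displacement of `y` by the elements `T s`. -/
def letterEnergy (T : S → Y ≃ᵢ Y) (y : Y) : ℝ :=
  ∑ s, (Fintype.card S : ℝ)⁻¹ * dist (T s y) y ^ 2

/-- The mean squared displacement of `y` by the words of length `m`. -/
def wordEnergy (T : S → Y ≃ᵢ Y) (m : ℕ) (y : Y) : ℝ :=
  (∑ w : Fin m → S, dist (wordProd T w y) y ^ 2) / (Fintype.card S : ℝ) ^ m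

theorem letterEnergy_nonneg (T : S → Y ≃ᵢ Y) (y : Y) : 0 ≤ letterEnergy T y :=
  Finset.sum_nonneg fun _ _ => by positivity

theorem continuous_letterEnergy (T : S → Y ≃ᵢ Y) : Continuous (letterEnergy T) := by
  have := fun s => (T s).continuous
  unfold letterEnergy
  fun_prop

theorem eq_of_letterEnergy_eq_zero [Nonempty S] {T : S → Y ≃ᵢ Y} {y : Y}
    (h : letterEnergy T y = 0) (s : S) : T s y = y := by
  have hc : (0 : ℝ) < (Fintype.card S : ℝ)⁻¹ := by
    have := Fintype.card_pos (α := S)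
    positivity
  have h1 := (Finset.sum_eq_zero_iff_of_nonneg fun _ _ => by positivity).1 h s (Finset.mem_univ s)
  have h2 := (mul_eq_zero.1 h1).resolve_left hc.ne'
  exact dist_eq_zero.1 (pow_eq_zero_iff two_ne_zero |>.1 h2)

theorem sum_inv_card [Nonempty S] : ∑ _ : S, (Fintype.card S : ℝ)⁻¹ = 1 := by
  have := Fintype.card_pos (α := S)
  rw [Finset.sum_const, Finset.card_univ, nsmul_eq_mul, mul_inv_cancel₀ (by positivity)]

theorem dist_apply_eq_dist_inv (g : Y ≃ᵢ Y) (x y : Y) : dist (g x) y = dist x (g⁻¹ y) := by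
  conv_lhs => rw [← (IsometryEquiv.apply_inv_self g y), g.dist_eq]

/-- The first letter is split off, replaced by its inverse and moved to the other side of the
distance. What remains is the mean squared distance from `w y` to the translates of `y`, to which
the variance inequality applies. -/
theorem wordEnergy_succ {T : S → Y ≃ᵢ Y} (inv : Equiv.Perm S) (hinv : ∀ s, T (inv s) = (T s)⁻¹)
    (m : ℕ) (y : Y) :
    wordEnergy T (m + 1) y = (∑ w : Fin m → S, ∑ s, (Fintype.card S : ℝ)⁻¹ *
      dist (T s y) (wordProd T w y) ^ 2) / (Fintype.card S : ℝ) ^ m := by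
  have h : ∑ w : Fin (m + 1) → S, dist (wordProd T w y) y ^ 2 =
      ∑ w : Fin m → S, ∑ s, dist (T s y) (wordProd T w y) ^ 2 := by
    rw [← (Fin.consEquiv fun _ => S).sum_comp, Fintype.sum_prod_type, Finset.sum_comm]
    refine Finset.sum_congr rfl fun w _ => ?_
    rw [← Equiv.sum_comp inv]
    refine Finset.sum_congr rfl fun s _ => ?_
    have : wordProd T (Fin.consEquiv (fun _ => S) (inv s, w)) = T (inv s) * wordProd T w :=
      wordProd_cons T _ w
    rw [this, hinv, IsometryEquiv.mul_apply, dist_apply_eq_dist_inv, inv_inv, dist_comm]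
  rw [wordEnergy, h]
  simp_rw [← Finset.mul_sum]
  rw [pow_succ, mul_comm (_ ^ m), ← div_div, inv_mul_eq_div]

/-- Young's inequality `(q + D)² ≤ q² / (1 - δ) + D² / δ`: a base point may be displaced by `δ √e`
at small cost. -/
theorem sq_le_of_le_add {x q D δ e : ℝ} (hx : 0 ≤ x) (hδ : 0 < δ) (hδ1 : δ < 1)
    (h : x ≤ q + D) (hD : D ^ 2 ≤ δ ^ 2 * e) : (1 - δ) * x ^ 2 - δ * e ≤ q ^ 2 := by
  have h1 : x ^ 2 ≤ (q + D) ^ 2 := by gcongr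
  have h2 : δ * (1 - δ) * x ^ 2 ≤ δ * (1 - δ) * (q + D) ^ 2 :=
    mul_le_mul_of_nonneg_left h1 (mul_nonneg hδ.le (by linarith))
  have h3 : 0 ≤ δ * (q ^ 2 - ((1 - δ) * x ^ 2 - δ * e)) := by
    nlinarith [sq_nonneg (δ * q - (1 - δ) * D), mul_nonneg hδ.le (sq_nonneg D)]
  linarith [nonneg_of_mul_nonneg_right h3 hδ]

/-- If `y` is close to the barycenter of its translates, then the mean squared displacement of the
random walk grows almost linearly. -/
theorem IsCAT0.wordEnergy_succ_ge [Nonempty S] (hY : IsCAT0 Y) {T : S → Y ≃ᵢ Y}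
    (inv : Equiv.Perm S) (hinv : ∀ s, T (inv s) = (T s)⁻¹) {y b : Y}
    (hb : IsBarycenter (fun _ : S => (Fintype.card S : ℝ)⁻¹) (fun s => T s y) b) {δ : ℝ}
    (hδ : 0 < δ) (hδ1 : δ < 1) (hD : dist y b ^ 2 ≤ δ ^ 2 * letterEnergy T y) (m : ℕ) :
    (1 - δ) * (wordEnergy T m y + letterEnergy T y) - 2 * δ * letterEnergy T y ≤
      wordEnergy T (m + 1) y := by
  have hq : (0 : ℝ) < Fintype.card S := by exact_mod_cast Fintype.card_pos
  set e := letterEnergy T y with he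
  set F := ∑ s, (Fintype.card S : ℝ)⁻¹ * dist (T s y) b ^ 2 with hF
  have hFe : (1 - δ) * e - δ * e ≤ F := by
    have h1 : ∀ s, (Fintype.card S : ℝ)⁻¹ * ((1 - δ) * dist (T s y) y ^ 2 - δ * e) ≤
        (Fintype.card S : ℝ)⁻¹ * dist (T s y) b ^ 2 := by
      intro s
      refine mul_le_mul_of_nonneg_left (sq_le_of_le_add dist_nonneg hδ hδ1 ?_ hD) (by positivity)
      rw [dist_comm y b]; exact dist_triangle _ _ _
    have h2 := Finset.sum_le_sum fun s (_ : s ∈ Finset.univ) => h1 s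
    have h3 : ∑ s, (Fintype.card S : ℝ)⁻¹ * ((1 - δ) * dist (T s y) y ^ 2 - δ * e) =
        (1 - δ) * e - (∑ _ : S, (Fintype.card S : ℝ)⁻¹) * (δ * e) := by
      have h4 : (1 - δ) * e = ∑ s, (1 - δ) * ((Fintype.card S : ℝ)⁻¹ * dist (T s y) y ^ 2) :=
        Finset.mul_sum _ _ _
      rw [h4, Finset.sum_mul, ← Finset.sum_sub_distrib]
      exact Finset.sum_congr rfl fun s _ => by ring
    rw [h3, sum_inv_card, one_mul] at h2
    exact h2
  -- Variance inequality at the point `w y`; then the barycenter `b` is exchanged for `y` in the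
  -- extra term.
  have hw : ∀ w : Fin m → S, F + ((1 - δ) * dist (wordProd T w y) y ^ 2 - δ * e) ≤
      ∑ s, (Fintype.card S : ℝ)⁻¹ * dist (T s y) (wordProd T w y) ^ 2 := by
    intro w
    refine le_trans ?_ (hY.variance_le (fun _ => by positivity) sum_inv_card hb _)
    have : dist (wordProd T w y) y ≤ dist b (wordProd T w y) + dist y b := by
      rw [dist_comm b, dist_comm y]; exact dist_triangle _ _ _
    linarith [sq_le_of_le_add dist_nonneg hδ hδ1 this hD]
  have hsum := Finset.sum_le_sum fun w (_ : w ∈ Finset.univ) => hw w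
  have hcard : (Fintype.card (Fin m → S) : ℝ) = (Fintype.card S : ℝ) ^ m := by simp
  have hlhs : ∑ w : Fin m → S, (F + ((1 - δ) * dist (wordProd T w y) y ^ 2 - δ * e)) =
      (F - δ * e + (1 - δ) * wordEnergy T m y) * (Fintype.card S : ℝ) ^ m := by
    rw [add_mul, ← hcard, wordEnergy, ← hcard, mul_assoc, div_mul_cancel₀ _ (by
      rw [hcard]; positivity), Finset.mul_sum, mul_comm _ (Fintype.card _ : ℝ), ← nsmul_eq_mul,
      ← Finset.card_univ, ← Finset.sum_const, ← Finset.sum_add_distrib]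
    exact Finset.sum_congr rfl fun w _ => by ring
  rw [hlhs, ← le_div_iff₀ (by positivity), ← wordEnergy_succ inv hinv] at hsum
  linarith

/-- Each letter adds one `letterEnergy`, with a relative loss of at most `δ * (m + 3) ≤ δ * (n + 3)`
against the ideal value `m`. -/
theorem IsCAT0.wordEnergy_ge [Nonempty S] (hY : IsCAT0 Y) {T : S → Y ≃ᵢ Y}
    (inv : Equiv.Perm S) (hinv : ∀ s, T (inv s) = (T s)⁻¹) {y b : Y}
    (hb : IsBarycenter (fun _ : S => (Fintype.card S : ℝ)⁻¹) (fun s => T s y) b) {δ : ℝ}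
    (hδ : 0 < δ) (hδ1 : δ < 1) (hD : dist y b ^ 2 ≤ δ ^ 2 * letterEnergy T y) {n : ℕ} :
    ∀ m ≤ n, (m - δ * m * (n + 3)) * letterEnergy T y ≤ wordEnergy T m y := by
  have he := letterEnergy_nonneg T y
  intro m
  induction m with
  | zero => intro _; simp [wordEnergy, wordProd_zero]
  | succ m ih =>
    intro hm
    have h1 := ih (by omega)
    have h2 := hY.wordEnergy_succ_ge inv hinv hb hδ hδ1 hD m
    have h3 := mul_le_mul_of_nonneg_left h1 (show 0 ≤ 1 - δ by linarith)
    have h4 : (m : ℝ) ≤ n := by exact_mod_cast (by omega : m ≤ n)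
    have h5 : 0 ≤ δ * ((n : ℝ) - m) * letterEnergy T y :=
      mul_nonneg (mul_nonneg hδ.le (by linarith)) he
    have h6 : 0 ≤ δ ^ 2 * m * (n + 3) * letterEnergy T y := by positivity
    push_cast
    linarith

/-- One averaging step: it decreases the energy by a definite factor as soon as the point is not
too close to the barycenter of its translates. -/
theorem IsCAT0.exists_letterEnergy_le [CompleteSpace Y] [Nonempty S] (hY : IsCAT0 Y)
    {T : S → Y ≃ᵢ Y} (inv : Equiv.Perm S) (hinv : ∀ s, T (inv s) = (T s)⁻¹) {n : ℕ} (hn : 0 < n)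
    {y : Y} (h : wordEnergy T n y ≤ (n - 1) * letterEnergy T y) :
    ∃ z, dist y z ^ 2 ≤ letterEnergy T y ∧
      letterEnergy T z ≤ (1 - (1 / (2 * n * (n + 3)) : ℝ) ^ 2) * letterEnergy T y := by
  have : Nonempty Y := ⟨y⟩
  have hq : (0 : ℝ) < Fintype.card S := by exact_mod_cast Fintype.card_pos
  have hn' : (1 : ℝ) ≤ n := by exact_mod_cast hn
  set e := letterEnergy T y with he
  have he0 : 0 ≤ e := letterEnergy_nonneg T y
  obtain ⟨b, hb⟩ := hY.exists_isBarycenter (fun _ => inv_nonneg.2 hq.le) (sum_inv_card (S := S))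
    (fun s => T s y)
  -- Makes the accumulated loss `δ * n * (n + 3)` equal to `1 / 2`: if `e > 0` and `y` were within
  -- `δ √e` of `b`, the `n`-step energy would be at least `(n - 1/2) * e`, against the hypothesis.
  set δ : ℝ := 1 / (2 * n * (n + 3)) with hδ
  have hδ0 : 0 < δ := by positivity
  have hδ1 : δ < 1 := by rw [hδ, div_lt_one (by positivity)]; nlinarith
  have hδn : δ * n * (n + 3) = 1 / 2 := by rw [hδ]; field_simp
  have hD : δ ^ 2 * e ≤ dist y b ^ 2 := by
    by_contra! hlt
    have h1 := hY.wordEnergy_ge inv hinv hb hδ0 hδ1 hlt.le (n := n) n le_rfl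
    rw [hδn] at h1
    have h2 : 0 < e := by
      by_contra! h0
      have : e = 0 := le_antisymm h0 he0
      rw [this, mul_zero] at hlt
      exact absurd hlt (not_lt.2 (sq_nonneg _))
    nlinarith
  obtain ⟨z, hyz, hz⟩ := hY.exists_sum_between (fun _ : S => inv_nonneg.2 hq.le) sum_inv_card
    (fun s => T s y) y b (t := 1 / 2) ⟨by norm_num, by norm_num⟩
  have hvar := hY.variance_le (fun _ => inv_nonneg.2 hq.le) sum_inv_card hb y
  have hFb : 0 ≤ ∑ s, (Fintype.card S : ℝ)⁻¹ * dist (T s y) b ^ 2 :=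
    Finset.sum_nonneg fun _ _ => by positivity
  change _ ≤ (1 - 1 / 2) * e + _ - _ at hz
  change _ ≤ e at hvar
  rw [dist_comm b y] at hvar
  refine ⟨z, ?_, ?_⟩
  · rw [hyz, mul_pow]; nlinarith [sq_nonneg (dist y b)]
  -- Here `z` is the midpoint of `y` and `b`. In the quadrilateral `T s z, y, z, T s y` the two
  -- displacements are the diagonals. Averaged over `s`, this bounds the energy of `z` by the mean
  -- squared distance from `z` to the translates of `y`; the bounds `hz` and `hvar` then leave at
  -- most `e - dist y b ^ 2`.
  · have hquad : ∀ s, dist (T s z) z ^ 2 + dist (T s y) y ^ 2 ≤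
        2 * dist y z ^ 2 + dist (T s y) z ^ 2 + dist (T s z) y ^ 2 := by
      intro s
      have := hY.quadrilateral (T s z) y z (T s y)
      rw [(T s).dist_eq, dist_comm y (T s y), dist_comm z (T s y)] at this
      linarith
    have hsum := Finset.sum_le_sum fun s (_ : s ∈ Finset.univ) =>
      mul_le_mul_of_nonneg_left (hquad s) (inv_nonneg.2 hq.le)
    simp only [mul_add, Finset.sum_add_distrib] at hsum
    rw [← Finset.sum_mul, sum_inv_card] at hsum
    have hsymm : ∑ s, (Fintype.card S : ℝ)⁻¹ * dist (T s z) y ^ 2 =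
        ∑ s, (Fintype.card S : ℝ)⁻¹ * dist (T s y) z ^ 2 := by
      rw [← Equiv.sum_comp inv]
      refine Finset.sum_congr rfl fun s _ => ?_
      rw [hinv, dist_apply_eq_dist_inv, inv_inv, dist_comm]
    rw [hsymm] at hsum
    change letterEnergy T z + e ≤ _ at hsum
    have h1 : dist y z ^ 2 = dist y b ^ 2 / 4 := by rw [hyz]; ring
    rw [h1] at hsum
    nlinarith

/-- If the `n`-step energy is less than `n - 1` times the one-step energy, then there is a common
fixed point. -/
theorem IsCAT0.exists_fixed_of_wordEnergy_le [CompleteSpace Y] [Nonempty Y] [Nonempty S]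
    (hY : IsCAT0 Y) {T : S → Y ≃ᵢ Y} (inv : Equiv.Perm S) (hinv : ∀ s, T (inv s) = (T s)⁻¹)
    {n : ℕ} (hn : 0 < n) (h : ∀ y, wordEnergy T n y ≤ (n - 1) * letterEnergy T y) :
    ∃ y, ∀ s, T s y = y := by
  choose f hf1 hf2 using fun y => hY.exists_letterEnergy_le inv hinv hn (h y)
  have hn' : (1 : ℝ) ≤ n := by exact_mod_cast hn
  set r : ℝ := 1 - (1 / (2 * n * (n + 3)) : ℝ) ^ 2 with hr
  have hr1 : r < 1 := by
    have : 0 < (1 / (2 * n * (n + 3)) : ℝ) ^ 2 := by positivity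
    linarith
  have hr0 : 0 ≤ r := by
    have : (1 / (2 * n * (n + 3)) : ℝ) ≤ 1 := by
      rw [div_le_one (by positivity)]; nlinarith
    have : (1 / (2 * n * (n + 3)) : ℝ) ^ 2 ≤ 1 := pow_le_one₀ (by positivity) this
    linarith
  obtain ⟨y₀⟩ := ‹Nonempty Y›
  set x : ℕ → Y := fun i => f^[i] y₀ with hx
  have hxs : ∀ i, x (i + 1) = f (x i) := fun i => Function.iterate_succ_apply' f i y₀
  have hE : ∀ i, letterEnergy T (x i) ≤ r ^ i * letterEnergy T y₀ := by
    intro i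
    induction i with
    | zero => simp [hx]
    | succ i ih =>
      rw [hxs, pow_succ', mul_assoc]
      exact (hf2 _).trans (mul_le_mul_of_nonneg_left ih hr0)
  -- A step is at most the square root of the current energy, which decays geometrically, so the
  -- total displacement is finite.
  have hdist : ∀ i, dist (x i) (x (i + 1)) ≤ Real.sqrt (letterEnergy T y₀) * Real.sqrt r ^ i := by
    intro i
    have h1 : dist (x i) (x (i + 1)) ^ 2 ≤ r ^ i * letterEnergy T y₀ := by
      rw [hxs]; exact (hf1 _).trans (hE i)
    refine (Real.le_sqrt_of_sq_le h1).trans_eq ?_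
    rw [Real.sqrt_mul (pow_nonneg hr0 i), mul_comm, Real.sqrt_eq_rpow (r ^ i),
      Real.sqrt_eq_rpow r, ← Real.rpow_natCast, ← Real.rpow_natCast, ← Real.rpow_mul hr0,
      ← Real.rpow_mul hr0, mul_comm (i : ℝ)]
  have hcau : CauchySeq x :=
    cauchySeq_of_le_geometric _ _ (by rw [Real.sqrt_lt' one_pos]; simpa using hr1) hdist
  obtain ⟨y, hy⟩ := cauchySeq_tendsto_of_complete hcau
  refine ⟨y, eq_of_letterEnergy_eq_zero (le_antisymm ?_ (letterEnergy_nonneg T y))⟩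
  have h1 := ((continuous_letterEnergy T).tendsto y).comp hy
  have h2 : Tendsto (fun i => r ^ i * letterEnergy T y₀) atTop (𝓝 (0 * letterEnergy T y₀)) :=
    (tendsto_pow_atTop_nhds_zero_of_lt_one hr0 hr1).mul_const _
  rw [zero_mul] at h2
  exact le_of_tendsto_of_tendsto' h1 h2 hE

end Criterion

/-! ### The logarithm map to the tangent cone -/

section Log

variable {Y : Type*} [MetricSpace Y]

/-- The Bruhat–Tits inequality used twice, once along each side. By the law of cosines, it says that
the comparison angle at `p` does not grow when the points move towards `p`. -/
theorem IsCAT0.dist_sq_geodesics_le (hY : IsCAT0 Y) {c c' : ℝ → Y} {l l' : ℝ} {p x x' : Y}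
    (hc : IsGeodesic c l p x) (hc' : IsGeodesic c' l' p x') {a a' : ℝ} (ha : a ∈ Icc (0 : ℝ) 1)
    (ha' : a' ∈ Icc (0 : ℝ) 1) :
    dist (c (a * l)) (c' (a' * l')) ^ 2 ≤
      a ^ 2 * l ^ 2 + a' ^ 2 * l' ^ 2 - a * a' * (l ^ 2 + l' ^ 2 - dist x x' ^ 2) := by
  have h1 := hY.dist_sq_le hc ha (c' (a' * l'))
  have h2 := hY.dist_sq_le hc' ha' x
  rw [dist_comm _ p, hc'.dist_source ⟨mul_nonneg ha'.1 hc'.nonneg,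
    mul_le_of_le_one_left hc'.nonneg ha'.2⟩, dist_comm _ x, hc.dist_eq] at h1
  rw [dist_comm x p, hc.dist_eq, hc'.dist_eq] at h2
  rw [dist_comm]
  nlinarith [mul_le_mul_of_nonneg_left h2 ha.1]

theorem IsCAT0.angle_le_comparisonAngle (hY : IsCAT0 Y) {p : Y} (c c' : GeodesicFrom p) :
    angle c c' ≤ comparisonAngle p (c.toFun c.length) (c'.toFun c'.length) := by
  refine limsup_le_of_le (isCoboundedUnder_comparisonAngle c c' _) ?_
  have hev : ∀ c : GeodesicFrom p, ∀ᶠ s in 𝓝[>] (0 : ℝ), 0 < s ∧ s < c.length :=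
    fun c => Ioo_mem_nhdsGT c.length_pos
  filter_upwards [(hev c).prod_mk (hev c')] with z hz
  obtain ⟨⟨h1, h2⟩, h3, h4⟩ := hz
  have hl := c.length_pos
  have hl' := c'.length_pos
  have key := hY.dist_sq_geodesics_le c.isGeodesic c'.isGeodesic
    (a := z.1 / c.length) (a' := z.2 / c'.length)
    ⟨by positivity, (div_le_one hl).2 h2.le⟩ ⟨by positivity, (div_le_one hl').2 h4.le⟩
  rw [div_mul_cancel₀ _ hl.ne', div_mul_cancel₀ _ hl'.ne', ← mul_pow, ← mul_pow,
    div_mul_cancel₀ _ hl.ne', div_mul_cancel₀ _ hl'.ne'] at key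
  refine Real.arccos_le_arccos ?_
  rw [c.isGeodesic.dist_eq, c'.isGeodesic.dist_eq, c.dist_base h1 h2, c'.dist_base h3 h4,
    le_div_iff₀ (by positivity)]
  refine le_of_eq_of_le ?_ (show z.1 / c.length * (z.2 / c'.length) * (c.length ^ 2 +
    c'.length ^ 2 - dist (c.toFun c.length) (c'.toFun c'.length) ^ 2) ≤ _ by linarith)
  field_simp

/-- The first variation inequality for the squared distance to the endpoint of `c'` along `c`. -/
theorem eventually_dist_sq_le {p : Y} (c c' : GeodesicFrom p) {ε : ℝ} (hε : 0 < ε) :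
    ∀ᶠ s in 𝓝[>] (0 : ℝ), dist (c'.toFun c'.length) (c.toFun s) ^ 2 ≤
      c'.length ^ 2 - 2 * c'.length * s * (Real.cos (angle c' c) - ε) + 4 * s ^ 2 := by
  have e := eventually_lt_of_limsup_lt (show angle c' c < angle c' c + ε / 2 by linarith)
    (isBoundedUnder_comparisonAngle c' c _)
  obtain ⟨η, hη, h⟩ := (nhdsGT_basis (0 : ℝ)).prod_self.eventually_iff.1 e
  -- The angle only controls pairs of points near `p`, while the far end of `c'` stays fixed. So
  -- `c'` is cut at `K * s`: the short triangle is governed by the angle, the rest of `c'` by the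
  -- triangle inequality. With `K` large, the side `√(K² + 1 - 2Kκ)` is at most `K - κ + 1 / (2 *
  -- K)`, and the error is at most `ε / 2`.
  set K := max 1 (1 / ε) with hK
  have hK1 : 1 ≤ K := le_max_left _ _
  have hK0 : 0 < K := by linarith
  have hKε : 1 / (2 * K) ≤ ε / 2 := by
    have : 1 / ε ≤ K := le_max_right _ _
    rw [div_le_iff₀ hε] at this
    rw [div_le_iff₀ (by positivity)]
    linarith
  have hl := c.length_pos
  have hl' := c'.length_pos
  filter_upwards [Ioo_mem_nhdsGT (show 0 < min (η / K) (min c.length (c'.length / K)) from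
    lt_min (div_pos hη hK0) (lt_min hl (div_pos hl' hK0)))] with s hs
  obtain ⟨hs0, hs1⟩ := hs
  obtain ⟨hs2, hs3, hs4⟩ : s < η / K ∧ s < c.length ∧ s < c'.length / K := by
    simpa [lt_min_iff] using hs1
  rw [lt_div_iff₀ hK0] at hs2 hs4
  have hsη : s < η := by nlinarith
  have hKs : 0 < K * s := by positivity
  have hcomp := @h (K * s, s) ⟨⟨hKs, by linarith⟩, hs0, hsη⟩
  simp only at hcomp
  have d1 := c'.dist_base hKs (by linarith)
  have d2 := c.dist_base hs0 hs3
  have D := dist_eq_thirdSide (p := p) (x := c'.toFun (K * s)) (y := c.toFun s)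
    (by rwa [d1]) (by rwa [d2])
  rw [d1, d2] at D
  set θ := comparisonAngle p (c'.toFun (K * s)) (c.toFun s) with hθ
  have hcos : Real.cos (angle c' c) - ε / 2 ≤ Real.cos θ := by
    rcases le_total θ (angle c' c) with h1 | h1
    · have := Real.cos_le_cos_of_nonneg_of_le_pi (comparisonAngle_nonneg _ _ _)
        (angle_le_pi c' c) h1
      linarith
    · have := (le_abs_self _).trans (Real.abs_cos_sub_cos_le (angle c' c) θ)
      rw [abs_sub_comm, abs_of_nonneg (by linarith)] at this
      linarith
  set κ := Real.cos θ
  have hκ1 : κ ≤ 1 := Real.cos_le_one _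
  have hκ2 : -1 ≤ κ := Real.neg_one_le_cos _
  have hK2 : 0 < 1 / (2 * K) := by positivity
  have hK3 : 1 / (2 * K) ≤ 1 := by rw [div_le_one (by positivity)]; linarith
  have hKK : K * (1 / (2 * K)) = 1 / 2 := by field_simp
  have hside : dist (c'.toFun (K * s)) (c.toFun s) ≤ s * (K - κ + 1 / (2 * K)) := by
    refine le_of_sq_le_sq ?_ (mul_nonneg hs0.le (by linarith))
    rw [D, thirdSide_sq, mul_pow s]
    have : (K - κ + 1 / (2 * K)) ^ 2 = K ^ 2 + 1 - 2 * K * κ + (κ - 1 / (2 * K)) ^ 2 := by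
      linear_combination 2 * hKK
    rw [this]
    nlinarith [mul_nonneg (sq_nonneg s) (sq_nonneg (κ - 1 / (2 * K)))]
  have hrest : dist (c'.toFun c'.length) (c'.toFun (K * s)) = c'.length - K * s := by
    rw [c'.isGeodesic.isom _ ⟨hl'.le, le_rfl⟩ _ ⟨hKs.le, by linarith⟩, abs_of_nonneg]
    linarith
  set m := κ - 1 / (2 * K) with hm
  have htri : dist (c'.toFun c'.length) (c.toFun s) ≤ c'.length - s * m := by
    have := dist_triangle (c'.toFun c'.length) (c'.toFun (K * s)) (c.toFun s)
    rw [hrest] at this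
    have e : s * (K - κ + 1 / (2 * K)) = K * s - s * m := by rw [hm]; ring
    linarith
  have hsq : dist (c'.toFun c'.length) (c.toFun s) ^ 2 ≤ (c'.length - s * m) ^ 2 := by gcongr
  have hm2 : m ^ 2 ≤ 4 := by nlinarith
  have hmε : Real.cos (angle c' c) - ε ≤ m := by linarith
  nlinarith [mul_le_mul_of_nonneg_left hmε (mul_pos hl' hs0).le,
    mul_le_mul_of_nonneg_left hm2 (sq_nonneg s)]

theorem IsCAT0.exists_geodesicFrom (hY : IsCAT0 Y) {p x : Y} (h : p ≠ x) :
    ∃ c : GeodesicFrom p, c.length = dist p x ∧ c.toFun c.length = x := by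
  obtain ⟨c, l, hc⟩ := hY.exists_geodesic p x
  have hl := hc.dist_eq
  refine ⟨⟨c, l, by rw [← hl]; exact dist_pos.2 h, by rw [hc.target]; exact hc⟩, hl.symm,
    hc.target⟩

open Classical in
/-- The logarithm map of a CAT(0) space at `p`. -/
def IsCAT0.log (hY : IsCAT0 Y) (p x : Y) : TangentCone p :=
  if h : p = x then .apex
  else .point ((hY.exists_geodesicFrom h).choose : SpaceOfDirections p) (dist p x) (dist_pos.2 h)

theorem IsCAT0.log_self (hY : IsCAT0 Y) (p : Y) : hY.log p p = .apex := dif_pos rfl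

theorem IsCAT0.log_of_ne (hY : IsCAT0 Y) {p x : Y} (h : p ≠ x) :
    ∃ c : GeodesicFrom p, c.length = dist p x ∧ c.toFun c.length = x ∧
      hY.log p x = .point (c : SpaceOfDirections p) (dist p x) (dist_pos.2 h) :=
  ⟨_, (hY.exists_geodesicFrom h).choose_spec.1, (hY.exists_geodesicFrom h).choose_spec.2,
    dif_neg h⟩

theorem IsCAT0.dist_log_apex (hY : IsCAT0 Y) (p x : Y) :
    dist (hY.log p x) EuclideanCone.apex = dist p x := by
  by_cases h : p = x
  · subst h; rw [hY.log_self, dist_self, dist_self]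
  · obtain ⟨c, -, -, e⟩ := hY.log_of_ne h
    rw [e]; rfl

/-- The angle is at most the comparison angle, and the third side grows with the angle. -/
theorem IsCAT0.dist_log_le (hY : IsCAT0 Y) (p x y : Y) :
    dist (hY.log p x) (hY.log p y) ≤ dist x y := by
  by_cases hx : p = x
  · subst hx; rw [hY.log_self, dist_comm, hY.dist_log_apex]
  by_cases hy : p = y
  · subst hy; rw [hY.log_self, hY.dist_log_apex, dist_comm]
  obtain ⟨c, hcl, hcx, e⟩ := hY.log_of_ne hx
  obtain ⟨c', hcl', hcy, e'⟩ := hY.log_of_ne hy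
  rw [e, e', dist_eq_thirdSide (dist_pos.2 hx) (dist_pos.2 hy)]
  change thirdSide _ _ (min (dist (c : SpaceOfDirections p) c') Real.pi) ≤ _
  rw [UniformSpace.Completion.dist_eq]
  change thirdSide _ _ (min (angle c c') Real.pi) ≤ _
  rw [min_eq_left (angle_le_pi c c')]
  have h := hY.angle_le_comparisonAngle c c'
  rw [hcx, hcy] at h
  exact thirdSide_mono dist_nonneg dist_nonneg (angle_nonneg c c') h (comparisonAngle_le_pi _ _ _)

/-- The cosine of the angle between the direction of `x` and `ξ`, and `0` if `x` is the apex. -/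
def EuclideanCone.cosAngle {S : Type*} [MetricSpace S] (ξ : S) : EuclideanCone S → ℝ
  | .apex => 0
  | .point u _ _ => Real.cos (min (dist u ξ) Real.pi)

theorem EuclideanCone.dist_point_sq {S : Type*} [MetricSpace S] (x : EuclideanCone S) (ξ : S)
    {t : ℝ} (ht : 0 < t) : dist x (.point ξ t ht) ^ 2 =
      dist x .apex ^ 2 + t ^ 2 - 2 * t * (dist x .apex * x.cosAngle ξ) := by
  cases x with
  | apex =>
    rw [dist_self]
    change t ^ 2 = _
    ring
  | point u r hr =>
    change thirdSide r t _ ^ 2 = r ^ 2 + t ^ 2 - 2 * t * (r * Real.cos _)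
    rw [thirdSide_sq]
    ring

theorem EuclideanCone.continuous_cosAngle {S : Type*} [MetricSpace S] (x : EuclideanCone S) :
    Continuous fun ξ => x.cosAngle ξ := by
  cases x with
  | apex => exact continuous_const
  | point u r hr =>
    change Continuous fun ξ => Real.cos (min (dist u ξ) Real.pi)
    fun_prop

theorem IsCAT0.eventually_dist_sq_le_log (hY : IsCAT0 Y) {p : Y} (c : GeodesicFrom p) (x : Y)
    {ε : ℝ} (hε : 0 < ε) :
    ∀ᶠ s in 𝓝[>] (0 : ℝ), dist x (c.toFun s) ^ 2 ≤ dist x p ^ 2 -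
      2 * s * (dist x p * (hY.log p x).cosAngle (c : SpaceOfDirections p)) +
        2 * s * ε * dist x p + 4 * s ^ 2 := by
  by_cases hx : p = x
  · subst hx
    filter_upwards [Ioo_mem_nhdsGT c.length_pos] with s hs
    rw [c.dist_base hs.1 hs.2, dist_self]
    nlinarith [sq_nonneg s]
  · obtain ⟨c', hcl, hcx, e⟩ := hY.log_of_ne hx
    have hcos : (hY.log p x).cosAngle (c : SpaceOfDirections p) = Real.cos (angle c' c) := by
      rw [e]
      change Real.cos (min (dist (c' : SpaceOfDirections p) c) Real.pi) = _
      rw [UniformSpace.Completion.dist_eq]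
      change Real.cos (min (angle c' c) Real.pi) = _
      rw [min_eq_left (angle_le_pi c' c)]
    filter_upwards [eventually_dist_sq_le c c' hε] with s hs
    rw [hcx, hcl] at hs
    rw [hcos, dist_comm x p]
    linarith

variable {V : Type*} [Fintype V]

/-- First-order condition at the minimizer: moving from `b` in the direction `ξ` cannot lower the
sum of squares. Directions of geodesics are dense, so they suffice; `s → 0` removes the quadratic
term and `ε → 0` the error of the first variation. -/
theorem IsCAT0.sum_cosAngle_log_nonpos (hY : IsCAT0 Y) {w : V → ℝ} (hw : ∀ u, 0 ≤ w u)
    {φ : V → Y} {b : Y} (hb : IsBarycenter w φ b) (ξ : SpaceOfDirections b) :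
    ∑ u, w u * (dist (φ u) b * (hY.log b (φ u)).cosAngle ξ) ≤ 0 := by
  induction ξ using UniformSpace.Completion.induction_on with
  | hp =>
    refine isClosed_le (continuous_finsetSum _ fun u _ => ?_) continuous_const
    exact continuous_const.mul (continuous_const.mul (EuclideanCone.continuous_cosAngle _))
  | ih c =>
    set Q := ∑ u, w u * (dist (φ u) b * (hY.log b (φ u)).cosAngle (c : SpaceOfDirections b))
      with hQ
    set R := ∑ u, w u * dist (φ u) b with hR
    set W := ∑ u, w u with hW
    have key : ∀ ε > 0, Q ≤ ε * R := by
      intro ε hε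
      have hev : ∀ᶠ s in 𝓝[>] (0 : ℝ), Q ≤ ε * R + 2 * s * W := by
        filter_upwards [eventually_all.2 fun u => hY.eventually_dist_sq_le_log c (φ u) hε,
          self_mem_nhdsWithin] with s hs hs0
        have hs0 : 0 < s := hs0
        have h1 := (hb (c.toFun s)).trans (Finset.sum_le_sum fun u _ =>
          mul_le_mul_of_nonneg_left (hs u) (hw u))
        have h2 : ∑ u, w u * (dist (φ u) b ^ 2 - 2 * s * (dist (φ u) b *
            (hY.log b (φ u)).cosAngle (c : SpaceOfDirections b)) +
              2 * s * ε * dist (φ u) b + 4 * s ^ 2) =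
            ∑ u, w u * dist (φ u) b ^ 2 - 2 * s * Q + 2 * s * ε * R + 4 * s ^ 2 * W := by
          rw [hQ, hR, hW, Finset.mul_sum, Finset.mul_sum, Finset.mul_sum,
            ← Finset.sum_sub_distrib, ← Finset.sum_add_distrib, ← Finset.sum_add_distrib]
          exact Finset.sum_congr rfl fun u _ => by ring
        rw [h2] at h1
        have h3 : 0 ≤ 2 * s * (ε * R + 2 * s * W - Q) := by linarith
        linarith [nonneg_of_mul_nonneg_right h3 (by positivity)]
      have hlim : Tendsto (fun s : ℝ => ε * R + 2 * s * W) (𝓝[>] 0) (𝓝 (ε * R + 2 * 0 * W)) :=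
        Tendsto.mono_left (Continuous.tendsto (by fun_prop) 0) nhdsWithin_le_nhds
      rw [mul_zero, zero_mul, add_zero] at hlim
      exact ge_of_tendsto hlim hev
    have hlim : Tendsto (fun ε : ℝ => ε * R) (𝓝[>] 0) (𝓝 (0 * R)) :=
      Tendsto.mono_left (Continuous.tendsto (by fun_prop) 0) nhdsWithin_le_nhds
    rw [zero_mul] at hlim
    refine ge_of_tendsto hlim ?_
    filter_upwards [self_mem_nhdsWithin] with ε hε using key ε hε

/-- By the cone law of cosines, moving from the apex to `(ξ, t)` changes the sum by `t²` times the
total weight minus `2t` times the nonpositive first-order term. -/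
theorem IsCAT0.isBarycenter_log (hY : IsCAT0 Y) {w : V → ℝ} (hw : ∀ u, 0 ≤ w u)
    {φ : V → Y} {b : Y} (hb : IsBarycenter w φ b) :
    IsBarycenter w (fun u => hY.log b (φ u)) .apex := by
  intro q
  cases q with
  | apex => rfl
  | point ξ t ht =>
    simp only [EuclideanCone.dist_point_sq, hY.dist_log_apex]
    have h := hY.sum_cosAngle_log_nonpos hw hb ξ
    have hW : 0 ≤ ∑ u, w u := Finset.sum_nonneg fun u _ => hw u
    have e : ∑ u, w u * (dist b (φ u) ^ 2 + t ^ 2 -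
        2 * t * (dist b (φ u) * (hY.log b (φ u)).cosAngle ξ)) =
        ∑ u, w u * dist b (φ u) ^ 2 + t ^ 2 * ∑ u, w u -
          2 * t * ∑ u, w u * (dist (φ u) b * (hY.log b (φ u)).cosAngle ξ) := by
      rw [Finset.mul_sum, Finset.mul_sum, ← Finset.sum_add_distrib, ← Finset.sum_sub_distrib]
      refine Finset.sum_congr rfl fun u _ => ?_
      rw [dist_comm b]; ring
    rw [e]
    nlinarith [mul_nonneg (sq_nonneg t) hW]

theorem randomWalk_nonneg (G : SimpleGraph V) [DecidableRel G.Adj] (u v : V) :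
    0 ≤ randomWalk G u v := by
  unfold randomWalk; split_ifs <;> positivity

theorem vertexMeasure_nonneg (G : SimpleGraph V) [DecidableRel G.Adj] (u : V) :
    0 ≤ vertexMeasure G u := by
  unfold vertexMeasure; positivity

/-- A lower bound for the Wang invariant of the tangent cone at the barycenter is a Poincaré
inequality for maps to the space. -/
theorem IsCAT0.poincare (hY : IsCAT0 Y) (G : SimpleGraph V) [DecidableRel G.Adj] {lam : ℝ}
    {φ : V → Y} {b : Y}
    (hb : IsBarycenter (vertexMeasure G) φ b)
    (hlam : ENNReal.ofReal lam ≤ wangInvariant G (TangentCone b)) :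
    lam * ∑ u, vertexMeasure G u * dist (φ u) b ^ 2 ≤
      (1 / 2) * ∑ u, vertexMeasure G u * ∑ v, randomWalk G u v * dist (φ u) (φ v) ^ 2 := by
  set ψ : V → TangentCone b := fun u => hY.log b (φ u) with hψ
  have hψb : IsBarycenter (vertexMeasure G) ψ .apex :=
    hY.isBarycenter_log (vertexMeasure_nonneg G) hb
  have hden : ∑ u, vertexMeasure G u * dist (ψ u) .apex ^ 2 =
      ∑ u, vertexMeasure G u * dist (φ u) b ^ 2 :=
    Finset.sum_congr rfl fun u _ => by rw [hψ, hY.dist_log_apex, dist_comm]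
  set A := ∑ u, vertexMeasure G u * dist (φ u) b ^ 2 with hA
  set B := (1 / 2) * ∑ u, vertexMeasure G u * ∑ v, randomWalk G u v * dist (φ u) (φ v) ^ 2
    with hB
  have hB0 : 0 ≤ B := mul_nonneg (by norm_num) <| Finset.sum_nonneg fun u _ =>
    mul_nonneg (vertexMeasure_nonneg G u) <| Finset.sum_nonneg fun v _ =>
      mul_nonneg (randomWalk_nonneg G u v) (sq_nonneg _)
  have hA0 : 0 ≤ A := Finset.sum_nonneg fun u _ =>
    mul_nonneg (vertexMeasure_nonneg G u) (sq_nonneg _)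
  rcases hA0.eq_or_lt with h0 | hpos
  · rw [← h0, mul_zero]; exact hB0
  -- If `ψ` were constant, its value would give sum `0`, below the positive minimum `A` attained at
  -- the apex.
  have hnc : ∃ u v, ψ u ≠ ψ v := by
    by_contra! hcon
    have hne : Nonempty V := by
      by_contra! hE
      simp [hA] at hpos
    obtain ⟨v⟩ := hne
    have h := hψb (ψ v)
    rw [hden] at h
    have : ∑ u, vertexMeasure G u * dist (ψ u) (ψ v) ^ 2 = 0 :=
      Finset.sum_eq_zero fun u _ => by rw [hcon u v, dist_self]; ring
    linarith
  have h1 : ENNReal.ofReal lam ≤ ENNReal.ofReal (rayleighQuotient G ψ .apex) :=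
    hlam.trans (iInf_le_of_le ψ (iInf_le_of_le hnc (iInf_le_of_le .apex (iInf_le _ hψb))))
  have hnum : (1 / 2) * ∑ u, vertexMeasure G u * ∑ v, randomWalk G u v * dist (ψ u) (ψ v) ^ 2 ≤
      B := by
    refine mul_le_mul_of_nonneg_left (Finset.sum_le_sum fun u _ => mul_le_mul_of_nonneg_left
      (Finset.sum_le_sum fun v _ => mul_le_mul_of_nonneg_left ?_ (randomWalk_nonneg G u v))
      (vertexMeasure_nonneg G u)) (by norm_num)
    gcongr
    exact hY.dist_log_le b _ _
  have h2 : rayleighQuotient G ψ .apex ≤ B / A := by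
    unfold rayleighQuotient
    rw [hden]
    gcongr
  have h3 : lam ≤ B / A :=
    (ENNReal.ofReal_le_ofReal_iff (div_nonneg hB0 hA0)).1
      (h1.trans (ENNReal.ofReal_le_ofReal h2))
  rwa [le_div_iff₀ hpos] at h3

end Log

/-! ### Paths without backtracking -/

section Graph

variable {V : Type*} {G : SimpleGraph V}

/-- A return to an earlier vertex would close up a cycle shorter than the girth. -/
theorem isPath_of_nonbacktracking {u v : V} (c : G.Walk u v)
    (hc : c.darts.IsChain fun e e' => e' ≠ e.symm) (hlen : (c.length : ℕ∞) < G.egirth) :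
    c.IsPath := by
  classical
  induction c with
  | nil => exact SimpleGraph.Walk.IsPath.nil
  | @cons u v w h p ih =>
    rw [SimpleGraph.Walk.darts_cons] at hc
    have hlen' : (p.length : ℕ∞) < G.egirth := by
      refine lt_of_le_of_lt ?_ hlen
      rw [SimpleGraph.Walk.length_cons]
      exact_mod_cast Nat.le_succ _
    have hp := ih hc.tail hlen'
    rw [SimpleGraph.Walk.cons_isPath_iff]
    refine ⟨hp, fun hu => ?_⟩
    have hcyc : (SimpleGraph.Walk.cons h (p.takeUntil u hu)).IsCycle := by
      rw [SimpleGraph.Walk.cons_isCycle_iff]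
      -- The closed walk is a cycle unless it repeats its first edge. As second edge that would be
      -- backtracking; later it would bring the path `p` back to its starting point.
      refine ⟨hp.takeUntil hu, fun hmem => ?_⟩
      cases p with
      | nil =>
        rw [SimpleGraph.Walk.support_nil, List.mem_singleton] at hu
        exact h.ne hu
      | @cons _ x _ h' q =>
        have huq : u ∈ q.support := by
          rw [SimpleGraph.Walk.support_cons, List.mem_cons] at hu
          exact hu.resolve_left h.ne
        rw [SimpleGraph.Walk.takeUntil_cons huq h.ne', SimpleGraph.Walk.edges_cons,
          List.mem_cons] at hmem
        rcases hmem with hmem | hmem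
        · have hx : x = u := by
            rcases Sym2.eq_iff.1 hmem with h1 | h1
            · exact absurd h1.1 h.ne
            · exact h1.1.symm
          subst hx
          rw [SimpleGraph.Walk.darts_cons, List.isChain_cons_cons] at hc
          exact hc.1 rfl
        · have hv := SimpleGraph.Walk.snd_mem_support_of_mem_edges _ hmem
          rw [SimpleGraph.Walk.cons_isPath_iff] at hp
          exact hp.2 (q.support_takeUntil_subset_support huq hv)
    have h1 := SimpleGraph.egirth_le_length hcyc
    have h2 : (SimpleGraph.Walk.cons h (p.takeUntil u hu)).length ≤
        (SimpleGraph.Walk.cons h p).length := by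
      rw [SimpleGraph.Walk.length_cons, SimpleGraph.Walk.length_cons]
      exact Nat.succ_le_succ (p.length_takeUntil_le_length hu)
    exact absurd (lt_of_le_of_lt (by exact_mod_cast h2) hlen) (not_lt.2 h1)

theorem exists_perm_forall_ne {α : Type*} [Fintype α] (h : 2 ≤ Fintype.card α) :
    ∃ τ : Equiv.Perm α, ∀ a, τ a ≠ a := by
  obtain ⟨m, hm⟩ := Nat.exists_eq_add_of_le h
  have ε : α ≃ Fin (m + 2) := Fintype.equivFinOfCardEq (by omega)
  refine ⟨(ε.trans (finRotate (m + 2))).trans ε.symm, fun a ha => ?_⟩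
  have h1 : finRotate (m + 2) (ε a) = ε a := ε.symm_apply_eq.1 ha
  have h2 : ε a ∈ (finRotate (m + 2)).support := by rw [support_finRotate]; exact Finset.mem_univ _
  exact Equiv.Perm.mem_support.1 h2 h1

/-- If there are no vertices of degree less than `2`, then the directed edges can be permuted
such that every edge is mapped to a continuation without backtracking. -/
theorem exists_dart_perm [Fintype V] [DecidableRel G.Adj] (hG : ∀ v, 2 ≤ G.degree v) :
    ∃ σ : Equiv.Perm G.Dart, ∀ e, (σ e).fst = e.snd ∧ σ e ≠ e.symm := by
  have hτ : ∀ v, ∃ τ : Equiv.Perm (G.neighborSet v), ∀ a, τ a ≠ a := fun v =>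
    exists_perm_forall_ne (by rw [G.card_neighborSet_eq_degree]; exact hG v)
  choose τ hτ using hτ
  -- The edge `(a, b)` continues to `(b, τ b a)`: injectivity of `τ b` makes `f` injective, and
  -- absence of fixed points prevents the return to `a`.
  set f : G.Dart → G.Dart := fun e =>
    ⟨(e.snd, (τ e.snd ⟨e.fst, e.adj.symm⟩ : G.neighborSet e.snd)),
      (τ e.snd ⟨e.fst, e.adj.symm⟩).2⟩ with hf
  have hinj : Function.Injective f := by
    rintro ⟨⟨a, b⟩, h⟩ ⟨⟨a', b'⟩, h'⟩ he
    have he := congrArg SimpleGraph.Dart.toProd he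
    obtain ⟨hb, ha⟩ := Prod.mk.inj he
    change b = b' at hb
    subst hb
    have haa' : a = a' := congrArg Subtype.val ((τ b).injective (Subtype.ext ha))
    subst haa'
    rfl
  refine ⟨Equiv.ofBijective f (Finite.injective_iff_bijective.1 hinj), fun e => ⟨rfl, fun he => ?_⟩⟩
  have h1 := congrArg (fun d : G.Dart => d.snd) he
  change ((τ e.snd ⟨e.fst, e.adj.symm⟩ : G.neighborSet e.snd) : V) = e.fst at h1
  exact hτ e.snd ⟨e.fst, e.adj.symm⟩ (Subtype.ext h1)

theorem exists_walk_darts_eq_ofFn {σ : G.Dart → G.Dart} (hσ : ∀ e, (σ e).fst = e.snd) (m : ℕ) :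
    ∀ e : G.Dart, ∃ c : G.Walk e.fst (σ^[m] e).fst,
      c.darts = List.ofFn fun i : Fin m => σ^[i] e := by
  induction m with
  | zero => exact fun e => ⟨.nil, by simp⟩
  | succ m ih =>
    intro e
    obtain ⟨c, hc⟩ := ih (σ e)
    refine ⟨.cons e.adj (c.copy (hσ e) (by rw [Function.iterate_succ_apply])), ?_⟩
    rw [SimpleGraph.Walk.darts_cons, SimpleGraph.Walk.darts_copy, hc, List.ofFn_succ]
    simp

/-- Distinct edges carry independent labels, so below the girth the word along `σ` is uniformly
distributed. -/
theorem injective_edge_iterate {σ : G.Dart → G.Dart} (hσ : ∀ e, (σ e).fst = e.snd)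
    (hσ' : ∀ e, σ e ≠ e.symm) {m : ℕ} (hm : (m : ℕ∞) < G.egirth) (e : G.Dart) :
    Function.Injective fun i : Fin m => (σ^[i] e).edge := by
  obtain ⟨c, hc⟩ := exists_walk_darts_eq_ofFn hσ m e
  have hlen : c.length = m := by rw [← c.length_darts, hc, List.length_ofFn]
  have hp : c.IsPath := by
    refine isPath_of_nonbacktracking c ?_ (by rwa [hlen])
    rw [hc, List.isChain_ofFn]
    intro i hi
    rw [Function.iterate_succ_apply']
    exact hσ' _
  have hn := hp.isTrail.edges_nodup
  rw [SimpleGraph.Walk.edges, hc, List.map_ofFn, List.nodup_ofFn] at hn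
  exact hn

variable [Fintype V] [DecidableRel G.Adj]

theorem sum_dart_eq (g : V → V → ℝ) :
    ∑ e : G.Dart, g e.fst e.snd = ∑ u, ∑ v, if G.Adj u v then g u v else 0 := by
  classical
  rw [← Fintype.sum_prod_type' (f := fun u v => if G.Adj u v then g u v else 0),
    ← Finset.sum_filter]
  refine Finset.sum_bij (fun e _ => e.toProd) ?_ ?_ ?_ ?_
  · exact fun e _ => Finset.mem_filter.2 ⟨Finset.mem_univ _, e.adj⟩
  · exact fun e _ e' _ h => SimpleGraph.Dart.ext _ _ h
  · exact fun p hp => ⟨⟨p, (Finset.mem_filter.1 hp).2⟩, Finset.mem_univ _, rfl⟩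
  · exact fun e _ => rfl

theorem sum_dart_fst_eq (g : V → ℝ) : ∑ e : G.Dart, g e.fst = ∑ u, G.degree u * g u := by
  rw [sum_dart_eq fun u _ => g u]
  refine Finset.sum_congr rfl fun u _ => ?_
  rw [← Finset.sum_filter, Finset.sum_const, nsmul_eq_mul, ← SimpleGraph.neighborFinset_eq_filter,
    SimpleGraph.card_neighborFinset_eq_degree]

theorem card_dart_eq : (Fintype.card G.Dart : ℝ) = 2 * (G.edgeSet.ncard : ℝ) := by
  classical
  rw [G.dart_card_eq_twice_card_edges, ← G.coe_edgeFinset, Set.ncard_coe_finset]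
  push_cast
  rfl

/-- The vertex measure is the law of the origin of a uniformly random directed edge. All averages
are thereby moved to directed edges, on which `σ` acts. -/
theorem sum_vertexMeasure_mul (g : V → ℝ) :
    ∑ u, vertexMeasure G u * g u = (∑ e : G.Dart, g e.fst) / Fintype.card G.Dart := by
  rw [sum_dart_fst_eq, card_dart_eq, Finset.sum_div]
  exact Finset.sum_congr rfl fun u _ => by rw [vertexMeasure]; ring

theorem sum_vertexMeasure [Nonempty G.Dart] : ∑ u, vertexMeasure G u = 1 := by
  have h := sum_vertexMeasure_mul (G := G) fun _ => 1
  simp only [mul_one, Finset.sum_const, Finset.card_univ, nsmul_eq_mul] at h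
  rw [h, div_self]
  exact_mod_cast Fintype.card_ne_zero

theorem sum_vertexMeasure_randomWalk (g : V → V → ℝ) :
    ∑ u, vertexMeasure G u * ∑ v, randomWalk G u v * g u v =
      (∑ e : G.Dart, g e.fst e.snd) / Fintype.card G.Dart := by
  rw [sum_dart_eq, card_dart_eq, Finset.sum_div]
  refine Finset.sum_congr rfl fun u _ => ?_
  rw [Finset.mul_sum, Finset.sum_div]
  refine Finset.sum_congr rfl fun v _ => ?_
  unfold vertexMeasure randomWalk
  split_ifs with h
  · have : (G.degree u : ℝ) ≠ 0 := by
      exact_mod_cast ((G.degree_pos_iff_exists_adj u).2 ⟨v, h⟩).ne'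
    field_simp
  · simp

end Graph

/-! ### Concentration for functions with bounded differences -/

section Concentration

variable {S : Type*} [Fintype S] [Nonempty S]

/-- Hoeffding's lemma by symmetrization: the product of the sums of `exp h` and `exp (-h)` is a
double sum of `cosh (h s - h s')`, at most `exp (c² / 2)` each, and Jensen bounds the second factor
from below. -/
theorem sum_exp_le_of_abs_sub_le {h : S → ℝ} {c : ℝ} (hc : ∀ s s', |h s - h s'| ≤ c) :
    ∑ s, Real.exp (h s) ≤
      Fintype.card S * Real.exp ((∑ s, h s) / Fintype.card S + c ^ 2 / 2) := by
  have hq : (0 : ℝ) < Fintype.card S := by exact_mod_cast Fintype.card_pos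
  set q : ℝ := (Fintype.card S : ℝ) with hqdef
  have hjensen : Real.exp (-((∑ s, h s) / q)) ≤ (∑ s, Real.exp (-h s)) / q := by
    have := convexOn_exp.map_sum_le (t := Finset.univ) (w := fun _ : S => q⁻¹)
      (p := fun s => -h s) (fun _ _ => by positivity) sum_inv_card (fun _ _ => mem_univ _)
    simp only [smul_eq_mul, ← Finset.mul_sum, Finset.sum_neg_distrib] at this
    rw [inv_mul_eq_div, inv_mul_eq_div, neg_div] at this
    exact this
  have hpair : (∑ s, Real.exp (h s)) * ∑ s, Real.exp (-h s) ≤ q * q * Real.exp (c ^ 2 / 2) := by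
    have e1 : (∑ s, Real.exp (h s)) * ∑ s, Real.exp (-h s) =
        ∑ s, ∑ s', Real.exp (h s - h s') := by
      rw [Finset.sum_mul_sum]
      simp only [← Real.exp_add, sub_eq_add_neg]
    have e2 : ∑ s, ∑ s', Real.exp (h s - h s') = ∑ s, ∑ s', Real.exp (-(h s - h s')) := by
      rw [Finset.sum_comm]
      simp only [neg_sub]
    have e3 : ∑ s, ∑ s', Real.exp (h s - h s') = ∑ s, ∑ s', Real.cosh (h s - h s') := by
      have : ∀ x, Real.cosh x = (1 / 2) * (Real.exp x + Real.exp (-x)) := fun x => by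
        rw [Real.cosh_eq]; ring
      simp only [this, ← Finset.mul_sum, Finset.sum_add_distrib]
      rw [← e2]; ring
    rw [e1, e3]
    have h4 : ∀ s s', Real.cosh (h s - h s') ≤ Real.exp (c ^ 2 / 2) := fun s s' => by
      refine (Real.cosh_le_exp_half_sq _).trans (Real.exp_le_exp.2 ?_)
      have : (h s - h s') ^ 2 ≤ c ^ 2 := sq_le_sq.2 ((hc s s').trans (le_abs_self c))
      linarith
    calc ∑ s, ∑ s', Real.cosh (h s - h s') ≤ ∑ _s : S, ∑ _s' : S, Real.exp (c ^ 2 / 2) :=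
          Finset.sum_le_sum fun s _ => Finset.sum_le_sum fun s' _ => h4 s s'
      _ = q * q * Real.exp (c ^ 2 / 2) := by
          simp only [Finset.sum_const, Finset.card_univ, nsmul_eq_mul]; ring
  have hpos : 0 ≤ ∑ s, Real.exp (h s) := Finset.sum_nonneg fun s _ => (Real.exp_pos _).le
  have h1 : (∑ s, Real.exp (h s)) * Real.exp (-((∑ s, h s) / q)) ≤
      q * Real.exp (c ^ 2 / 2) := by
    refine (mul_le_mul_of_nonneg_left hjensen hpos).trans ?_
    rw [← mul_div_assoc, div_le_iff₀ hq]
    linarith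
  rw [Real.exp_neg, ← div_eq_mul_inv, div_le_iff₀ (Real.exp_pos _)] at h1
  rw [Real.exp_add]
  linarith

/-- Induction on coordinates: with the first one fixed, the inductive hypothesis applies, and the
conditional mean `h` varies by at most `c`. -/
theorem sum_exp_le_of_bounded_differences (N : ℕ) {c : ℝ} :
    ∀ f : (Fin N → S) → ℝ, (∀ i g g', (∀ j, j ≠ i → g j = g' j) → |f g - f g'| ≤ c) →
      ∑ g, Real.exp (f g) ≤ (Fintype.card S : ℝ) ^ N *
        Real.exp ((∑ g, f g) / (Fintype.card S : ℝ) ^ N + N * c ^ 2 / 2) := by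
  have hq : (0 : ℝ) < Fintype.card S := by exact_mod_cast Fintype.card_pos
  set q : ℝ := (Fintype.card S : ℝ) with hqdef
  induction N with
  | zero => intro f _; simp
  | succ N ih =>
    intro f hf
    have hsplit : ∀ F : (Fin (N + 1) → S) → ℝ,
        ∑ g, F g = ∑ s, ∑ g : Fin N → S, F (Fin.cons s g) := fun F => by
      rw [← (Fin.consEquiv fun _ => S).sum_comp, Fintype.sum_prod_type]; rfl
    set h : S → ℝ := fun s => (∑ g : Fin N → S, f (Fin.cons s g)) / q ^ N with hh
    have h1 : ∀ s, ∑ g : Fin N → S, Real.exp (f (Fin.cons s g)) ≤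
        q ^ N * Real.exp (N * c ^ 2 / 2) * Real.exp (h s) := by
      intro s
      have := ih (fun g => f (Fin.cons s g)) fun i g g' hgg' => hf i.succ _ _ fun j hj => by
        induction j using Fin.cases with
        | zero => simp
        | succ j =>
          rw [Fin.cons_succ, Fin.cons_succ]
          exact hgg' j fun hji => hj (by rw [hji])
      rw [Real.exp_add] at this
      linarith
    have hhc : ∀ s s', |h s - h s'| ≤ c := by
      intro s s'
      have hcard : (Fintype.card (Fin N → S) : ℝ) = q ^ N := by simp [hqdef]
      rw [hh, ← sub_div, ← Finset.sum_sub_distrib, abs_div, abs_of_pos (by positivity : 0 < q ^ N),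
        div_le_iff₀ (by positivity)]
      refine (Finset.abs_sum_le_sum_abs _ _).trans ((Finset.sum_le_card_nsmul _ _ c
        fun g _ => hf 0 _ _ fun j hj => ?_).trans_eq ?_)
      · induction j using Fin.cases with
        | zero => exact absurd rfl hj
        | succ j => simp
      · rw [nsmul_eq_mul, Finset.card_univ, hcard, mul_comm]
    have h2 := sum_exp_le_of_abs_sub_le hhc
    have h3 : (∑ s, h s) / q = (∑ g, f g) / q ^ (N + 1) := by
      rw [hsplit f, hh, ← Finset.sum_div, div_div, pow_succ]
    rw [← hqdef, h3] at h2
    rw [hsplit fun g => Real.exp (f g)]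
    refine (Finset.sum_le_sum fun s _ => h1 s).trans ?_
    rw [← Finset.mul_sum]
    refine (mul_le_mul_of_nonneg_left h2 (by positivity)).trans_eq ?_
    push_cast
    rw [show (∑ g, f g) / q ^ (N + 1) + ((N : ℝ) + 1) * c ^ 2 / 2 =
      N * c ^ 2 / 2 + ((∑ g, f g) / q ^ (N + 1) + c ^ 2 / 2) by ring, Real.exp_add (N * c ^ 2 / 2)]
    ring

/-- McDiarmid's inequality for the uniform measure on a finite product, up to the constant. -/
theorem card_filter_le_of_bounded_differences {ι : Type*} [Fintype ι] [DecidableEq ι]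
    [Nonempty ι] {f : (ι → S) → ℝ} {c t M : ℝ} (hc0 : 0 < c) (ht : 0 ≤ t)
    (hf : ∀ i g g', (∀ j, j ≠ i → g j = g' j) → |f g - f g'| ≤ c)
    (hM : ∑ g, f g = M * Fintype.card (ι → S)) :
    ((Finset.univ.filter fun g => M + t ≤ f g).card : ℝ) ≤
      Fintype.card (ι → S) * Real.exp (-(t ^ 2 / (2 * Fintype.card ι * c ^ 2))) := by
  set N := Fintype.card ι with hN
  have hN0 : (0 : ℝ) < N := by exact_mod_cast Fintype.card_pos
  have ε : Fin N ≃ ι := (Fintype.equivFin ι).symm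
  set e : (Fin N → S) ≃ (ι → S) := ε.arrowCongr (Equiv.refl S) with he
  have hea : ∀ g i, e g i = g (ε.symm i) := fun g i => rfl
  have hcard : (Fintype.card (ι → S) : ℝ) = (Fintype.card S : ℝ) ^ N := by
    rw [Fintype.card_fun]; push_cast; rfl
  have hq : (0 : ℝ) < Fintype.card S := by exact_mod_cast Fintype.card_pos
  -- Minimizes the Chernoff exponent `-r * t + N * r² * c² / 2`.
  set r := t / (N * c ^ 2) with hr
  have hr0 : 0 ≤ r := by positivity
  have h1 := sum_exp_le_of_bounded_differences N (c := r * c) (fun g => r * f (e g)) (by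
    intro i g g' hgg'
    rw [← mul_sub, abs_mul, abs_of_nonneg hr0]
    refine mul_le_mul_of_nonneg_left (hf (ε i) _ _ fun j hj => ?_) hr0
    rw [hea, hea]
    exact hgg' _ fun h => hj (by rw [← h, ε.apply_symm_apply]))
  rw [← Finset.mul_sum, Equiv.sum_comp e f, Equiv.sum_comp e fun g => Real.exp (r * f g), hM,
    ← hcard, ← mul_assoc, mul_div_cancel_right₀ _ (by rw [hcard]; positivity)] at h1
  have h2 : ((Finset.univ.filter fun g => M + t ≤ f g).card : ℝ) * Real.exp (r * (M + t)) ≤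
      ∑ g, Real.exp (r * f g) := by
    rw [← nsmul_eq_mul]
    refine (Finset.card_nsmul_le_sum _ (fun g => Real.exp (r * f g)) _ fun g hg => ?_).trans
      (Finset.sum_le_sum_of_subset_of_nonneg (Finset.filter_subset _ _)
        fun g _ _ => (Real.exp_pos _).le)
    exact Real.exp_le_exp.2 (mul_le_mul_of_nonneg_left (Finset.mem_filter.1 hg).2 hr0)
  have h3 := h2.trans h1
  rw [← le_div_iff₀ (Real.exp_pos _), mul_div_assoc, ← Real.exp_sub] at h3
  refine h3.trans_eq ?_
  congr 2
  rw [hr]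
  field_simp
  ring

end Concentration

/-! ### Random labellings -/

section RandomLabelling

/-- Independence of values at distinct places, in counting form. -/
theorem card_filter_prescribed {ι S : Type*} [Fintype ι] [DecidableEq ι] [Fintype S]
    [DecidableEq S] {m : ℕ} {j : Fin m → ι}
    (hj : Function.Injective j) (c : Fin m → S) :
    (Finset.univ.filter fun g : ι → S => ∀ i, g (j i) = c i).card * Fintype.card S ^ m =
      Fintype.card (ι → S) := by
  have h1 : (Finset.univ.filter fun g : ι → S => ∀ i, g (j i) = c i) =
      Fintype.piFinset fun x => Finset.univ.filter fun s => ∀ i, j i = x → s = c i := by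
    ext g
    simp only [Finset.mem_filter, Finset.mem_univ, true_and, Fintype.mem_piFinset]
    exact ⟨fun h x i hi => by rw [← hi, h], fun h i => h _ i rfl⟩
  have h2 : ∀ x, (Finset.univ.filter fun s => ∀ i, j i = x → s = c i).card =
      if x ∈ Finset.univ.image j then 1 else Fintype.card S := by
    intro x
    split_ifs with hx
    · obtain ⟨i, -, rfl⟩ := Finset.mem_image.1 hx
      rw [Finset.card_eq_one]
      refine ⟨c i, ?_⟩
      ext s
      simp only [Finset.mem_filter, Finset.mem_univ, true_and, Finset.mem_singleton]
      exact ⟨fun h => h i rfl, fun h i' hi' => by rw [hj hi', h]⟩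
    · rw [← Finset.card_univ]
      congr 1
      refine Finset.filter_true_of_mem fun s _ i hi => absurd ?_ hx
      exact Finset.mem_image.2 ⟨i, Finset.mem_univ _, hi⟩
  have h3 : (Finset.univ.image j).card = m := by
    rw [Finset.card_image_of_injective _ hj, Finset.card_univ, Fintype.card_fin]
  rw [h1, Fintype.card_piFinset, Finset.prod_congr rfl fun x _ => h2 x, Finset.prod_ite,
    Finset.prod_const_one, one_mul, Finset.prod_const, ← pow_add, Fintype.card_fun]
  congr 1
  have h4 := Finset.card_filter_add_card_filter_not (s := Finset.univ)
    (fun x => x ∈ Finset.univ.image j)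
  have h5 : (Finset.univ.filter fun x => x ∈ Finset.univ.image j) = Finset.univ.image j := by
    ext x; simp
  rw [h5, h3, Finset.card_univ] at h4
  omega

/-- The number of elements `e` of `D` for which a random function takes prescribed values at the
`m` places `j e`, after a change of coordinates in the values. -/
def matchCount {D ι S : Type*} [Fintype D] {m : ℕ} (j : D → Fin m → ι)
    (π : D → Fin m → Equiv.Perm S) (w : Fin m → S) (g : ι → S) : ℝ :=
  (Nat.card {e : D // (fun i => π e i (g (j e i))) = w} : ℝ)

section MatchCount

variable {D ι S : Type*} [Fintype D] {m : ℕ} {j : D → Fin m → ι}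
  {π : D → Fin m → Equiv.Perm S} {w : Fin m → S}

theorem matchCount_eq_sum [DecidableEq S] (g : ι → S) :
    matchCount j π w g = ∑ e : D, if (fun i => π e i (g (j e i))) = w then (1 : ℝ) else 0 := by
  rw [matchCount, Nat.card_eq_fintype_card, Fintype.card_subtype, Finset.sum_boole]

theorem sum_matchCount [Fintype ι] [DecidableEq ι] [Fintype S] [Nonempty S]
    (hj : ∀ e, Function.Injective (j e)) :
    ∑ g, matchCount j π w g =
      Fintype.card D / (Fintype.card S : ℝ) ^ m * Fintype.card (ι → S) := by
  classical
  have hq : (0 : ℝ) < Fintype.card S := by exact_mod_cast Fintype.card_pos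
  simp only [matchCount_eq_sum]
  rw [Finset.sum_comm]
  have h1 : ∀ e, ∑ g : ι → S, (if (fun i => π e i (g (j e i))) = w then (1 : ℝ) else 0) =
      Fintype.card (ι → S) / (Fintype.card S : ℝ) ^ m := by
    intro e
    rw [Finset.sum_boole, eq_div_iff (by positivity)]
    have h := card_filter_prescribed (hj e) (fun i => (π e i).symm (w i))
    have h2 : (Finset.univ.filter fun g : ι → S => (fun i => π e i (g (j e i))) = w) =
        Finset.univ.filter fun g : ι → S => ∀ i, g (j e i) = (π e i).symm (w i) := by
      ext g
      simp only [Finset.mem_filter, Finset.mem_univ, true_and, funext_iff, Equiv.eq_symm_apply]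
    rw [h2]
    exact_mod_cast h
  rw [Finset.sum_congr rfl fun e _ => h1 e, Finset.sum_const, nsmul_eq_mul, Finset.card_univ]
  ring

/-- A change at `x` affects only those `e` with `j e i = x` for some `i`, at most `l` for each of
the `m` indices. -/
theorem abs_matchCount_sub_le {l : ℕ} (hl : ∀ x i, Nat.card {e // j e i = x} ≤ l) (x : ι)
    (g g' : ι → S) (h : ∀ y, y ≠ x → g y = g' y) :
    |matchCount j π w g - matchCount j π w g'| ≤ l * m := by
  classical
  rw [matchCount_eq_sum, matchCount_eq_sum, ← Finset.sum_sub_distrib]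
  refine (Finset.abs_sum_le_sum_abs _ _).trans ?_
  have h1 : ∀ e, |(if (fun i => π e i (g (j e i))) = w then (1 : ℝ) else 0) -
      (if (fun i => π e i (g' (j e i))) = w then (1 : ℝ) else 0)| ≤
        ∑ i, if j e i = x then (1 : ℝ) else 0 := by
    intro e
    by_cases hx : ∃ i, j e i = x
    · obtain ⟨i, hi⟩ := hx
      have h2 : (1 : ℝ) ≤ ∑ i, if j e i = x then (1 : ℝ) else 0 := by
        have := Finset.single_le_sum (f := fun i => if j e i = x then (1 : ℝ) else 0)
          (fun i _ => by positivity) (Finset.mem_univ i)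
        simpa [hi] using this
      refine le_trans ?_ h2
      split_ifs <;> simp
    · push Not at hx
      have : (fun i => π e i (g (j e i))) = fun i => π e i (g' (j e i)) :=
        funext fun i => by rw [h _ (hx i)]
      rw [this, sub_self, abs_zero]
      exact Finset.sum_nonneg fun i _ => by positivity
  refine (Finset.sum_le_sum fun e _ => h1 e).trans ?_
  rw [Finset.sum_comm]
  have h2 : ∀ i : Fin m, ∑ e, (if j e i = x then (1 : ℝ) else 0) ≤ l := by
    intro i
    rw [Finset.sum_boole, ← Fintype.card_subtype, ← Nat.card_eq_fintype_card]
    exact_mod_cast hl x i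
  refine (Finset.sum_le_sum fun i _ => h2 i).trans_eq ?_
  rw [Finset.sum_const, Finset.card_univ, Fintype.card_fin, nsmul_eq_mul, mul_comm]

theorem card_matchCount_deviation_le [Fintype ι] [DecidableEq ι] [Fintype S] [Nonempty S]
    [Nonempty ι] (hm : 0 < m)
    (hj : ∀ e, Function.Injective (j e)) (hl : ∀ x i, Nat.card {e // j e i = x} ≤ 2)
    (hD : Fintype.card D = 2 * Fintype.card ι) :
    ((Finset.univ.filter fun g : ι → S =>
        3 / 2 * (Fintype.card D / (Fintype.card S : ℝ) ^ m) ≤ matchCount j π w g).card : ℝ) ≤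
      Fintype.card (ι → S) *
        Real.exp (-(1 / (8 * m ^ 2 * (Fintype.card S : ℝ) ^ (2 * m))) * Fintype.card ι) ∧
    ((Finset.univ.filter fun g : ι → S =>
        matchCount j π w g ≤ 1 / 2 * (Fintype.card D / (Fintype.card S : ℝ) ^ m)).card : ℝ) ≤
      Fintype.card (ι → S) *
        Real.exp (-(1 / (8 * m ^ 2 * (Fintype.card S : ℝ) ^ (2 * m))) * Fintype.card ι) := by
  have hq : (0 : ℝ) < Fintype.card S := by exact_mod_cast Fintype.card_pos
  have hι : (0 : ℝ) < Fintype.card ι := by exact_mod_cast Fintype.card_pos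
  have hm' : (0 : ℝ) < m := by exact_mod_cast hm
  have hD' : (Fintype.card D : ℝ) = 2 * Fintype.card ι := by exact_mod_cast hD
  set M : ℝ := Fintype.card D / (Fintype.card S : ℝ) ^ m with hM
  have hM0 : 0 ≤ M := by positivity
  have hbd := abs_matchCount_sub_le (j := j) (π := π) (w := w) hl
  have hsum := sum_matchCount (π := π) (w := w) hj
  -- Deviation by half the mean `M`, with differences bounded by `2 * m`; the exponent is linear in
  -- the number of edges because `M` is.
  have hexp : -((M / 2) ^ 2 / (2 * Fintype.card ι * ((2 : ℕ) * m : ℝ) ^ 2)) =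
      -(1 / (8 * m ^ 2 * (Fintype.card S : ℝ) ^ (2 * m))) * Fintype.card ι := by
    rw [hM, hD', pow_mul']
    push_cast
    field_simp
    ring
  constructor
  · have h := card_filter_le_of_bounded_differences (t := M / 2) (c := (2 : ℕ) * m)
      (by positivity) (by positivity) hbd hsum
    rw [hexp] at h
    refine le_trans (Nat.cast_le.2 (Finset.card_le_card fun g hg => ?_)) h
    simp only [Finset.mem_filter, Finset.mem_univ, true_and] at hg ⊢
    linarith
  · have h := card_filter_le_of_bounded_differences (t := M / 2) (c := (2 : ℕ) * m) (M := -M)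
      (f := fun g => -matchCount j π w g) (by positivity) (by positivity)
      (fun i g g' hg => by
        have := hbd i g g' hg
        rwa [← abs_neg, neg_sub, ← neg_sub_neg] at this)
      (by rw [Finset.sum_neg_distrib, hsum, neg_mul])
    rw [hexp] at h
    refine le_trans (Nat.cast_le.2 (Finset.card_le_card fun g hg => ?_)) h
    simp only [Finset.mem_filter, Finset.mem_univ, true_and] at hg ⊢
    linarith

end MatchCount

variable {V : Type*} {G : SimpleGraph V} {k : ℕ}

/-- Inversion of letters. -/
def invLetter : Equiv.Perm (Fin k × Bool) :=
  Function.Involutive.toPerm (fun s => (s.1, !s.2)) fun s => by simp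

theorem invLetter_apply (s : Fin k × Bool) : invLetter s = (s.1, !s.2) := rfl

theorem invLetter_invLetter (s : Fin k × Bool) : invLetter (invLetter s) = s := by
  simp [invLetter_apply]

variable (G k) in
/-- A labelling amounts to an arbitrary choice of a letter for each undirected edge. -/
theorem exists_labelling_equiv :
    ∃ (E : Labelling G k ≃ (G.edgeSet → Fin k × Bool)) (π : G.Dart → Equiv.Perm (Fin k × Bool)),
      ∀ α e, α.1 e = π e (E α ⟨e.edge, e.edge_mem⟩) := by
  classical
  have hr : ∀ x : G.edgeSet, ∃ e : G.Dart, e.edge = x := by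
    rintro ⟨x, hx⟩
    induction x using Sym2.ind with
    | _ u v => exact ⟨⟨(u, v), hx⟩, rfl⟩
  -- An orientation of every edge. `R e` is the chosen direction of the edge of `e`, and `π e`
  -- inverts the letter exactly when `e` points the other way.
  choose r hr using hr
  set R : G.Dart → G.Dart := fun e => r ⟨e.edge, e.edge_mem⟩ with hR
  have hRe : ∀ e, e = R e ∨ e = (R e).symm := fun e =>
    SimpleGraph.dart_edge_eq_iff _ _ |>.1 (hr ⟨e.edge, e.edge_mem⟩).symm
  have hRs : ∀ e : G.Dart, R e.symm = R e := fun e => by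
    have : (⟨e.symm.edge, e.symm.edge_mem⟩ : G.edgeSet) = ⟨e.edge, e.edge_mem⟩ :=
      Subtype.ext e.edge_symm
    simp only [hR, this]
  have hRr : ∀ x, R (r x) = r x := fun x => by
    have : (⟨(r x).edge, (r x).edge_mem⟩ : G.edgeSet) = x := Subtype.ext (hr x)
    simp only [hR, this]
  set π : G.Dart → Equiv.Perm (Fin k × Bool) := fun e => if e = R e then 1 else invLetter with hπ
  have hα : ∀ (α : Labelling G k) e, α.1 e = π e (α.1 (R e)) := by
    intro α e
    by_cases h : e = R e
    · simp only [hπ, if_pos h, Equiv.Perm.one_apply]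
      exact congrArg α.1 h
    · simp only [hπ, if_neg h]
      have h' := (hRe e).resolve_left h
      conv_lhs => rw [h', α.2]
      rfl
  have hsymm : ∀ (g : G.edgeSet → Fin k × Bool) (e : G.Dart),
      π e.symm (g ⟨e.symm.edge, e.symm.edge_mem⟩) = invLetter (π e (g ⟨e.edge, e.edge_mem⟩)) := by
    intro g e
    have h1 : (⟨e.symm.edge, e.symm.edge_mem⟩ : G.edgeSet) = ⟨e.edge, e.edge_mem⟩ :=
      Subtype.ext e.edge_symm
    rw [h1]
    simp only [hπ, hRs]
    by_cases h : e = R e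
    · have h' : e.symm ≠ R e := fun h' => e.symm_ne (h'.trans h.symm)
      rw [if_neg h', if_pos h, Equiv.Perm.one_apply]
    · have h' : e.symm = R e :=
        (congrArg SimpleGraph.Dart.symm ((hRe e).resolve_left h)).trans
          (SimpleGraph.Dart.symm_symm _)
      rw [if_pos h', if_neg h, Equiv.Perm.one_apply, invLetter_invLetter]
  refine ⟨⟨fun α x => α.1 (r x), fun g => ⟨fun e => π e (g ⟨e.edge, e.edge_mem⟩), fun e =>
    hsymm g e⟩, fun α => Subtype.ext (funext fun e => (hα α e).symm), fun g => ?_⟩, π, hα⟩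
  funext x
  have h1 : (⟨(r x).edge, (r x).edge_mem⟩ : G.edgeSet) = x := Subtype.ext (hr x)
  simp only [h1, hπ, hRr, if_true, Equiv.Perm.one_apply]

/-- The word read along the path `e, σ e, …, σ^(m-1) e`. -/
def Labelling.pathWord (α : Labelling G k) (σ : G.Dart → G.Dart) (m : ℕ) (e : G.Dart) :
    Fin m → Fin k × Bool := fun i => α.1 (σ^[i] e)

/-- The letters and the words of length `n` along the paths given by `σ` are nearly
equidistributed. -/
structure Labelling.IsEquidistributed (α : Labelling G k) (σ : G.Dart → G.Dart) (n : ℕ) :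
    Prop where
  letter_le : ∀ w : Fin 1 → Fin k × Bool, (Nat.card {e // α.pathWord σ 1 e = w} : ℝ) ≤
    3 / 2 * (Nat.card G.Dart / (2 * k : ℝ) ^ 1)
  le_word : ∀ w : Fin n → Fin k × Bool, 1 / 2 * (Nat.card G.Dart / (2 * k : ℝ) ^ n) ≤
    (Nat.card {e // α.pathWord σ n e = w} : ℝ)

/-- Iterates of `σ` are bijective and each edge has two directions; this keeps the influence of a
single label bounded. -/
theorem card_edge_fiber_le [Fintype V] (σ : Equiv.Perm G.Dart) (x : G.edgeSet) (i : ℕ) :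
    Nat.card {e : G.Dart // (⟨(σ^[i] e).edge, (σ^[i] e).edge_mem⟩ : G.edgeSet) = x} ≤ 2 := by
  classical
  have h1 : Nat.card {e : G.Dart // (⟨(σ^[i] e).edge, (σ^[i] e).edge_mem⟩ : G.edgeSet) = x} =
      Nat.card {e : G.Dart // e.edge = x} := by
    refine Nat.card_congr ((σ ^ i).subtypeEquiv fun e => ?_)
    rw [Subtype.ext_iff, ← Equiv.Perm.iterate_eq_pow]
  rw [h1, Nat.card_eq_fintype_card, Fintype.card_subtype, G.dart_edge_fiber_card x x.2]

theorem labellingProb_ge {P : Labelling G k → Prop} {b : ℝ} [Finite (Labelling G k)]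
    [Nonempty (Labelling G k)]
    (h : (Nat.card {α : Labelling G k // ¬ P α} : ℝ) ≤ b * Nat.card (Labelling G k)) :
    1 - b ≤ labellingProb G k P := by
  classical
  have := Fintype.ofFinite (Labelling G k)
  have hpos : (0 : ℝ) < Nat.card (Labelling G k) := by exact_mod_cast Nat.card_pos
  rw [labellingProb, le_div_iff₀ hpos]
  have h1 : Nat.card {α : Labelling G k // P α} + Nat.card {α : Labelling G k // ¬ P α} =
      Nat.card (Labelling G k) := by
    rw [← Nat.card_sum, Nat.card_congr (Equiv.sumCompl P)]
  have h2 : (Nat.card {α : Labelling G k // P α} : ℝ) + Nat.card {α : Labelling G k // ¬ P α} =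
      Nat.card (Labelling G k) := by exact_mod_cast h1
  linarith

end RandomLabelling

/-! ### Equidistribution holds outside an exponentially small set of labellings -/

section Equidistribution

variable {V : Type*} [Fintype V] {G : SimpleGraph V} [DecidableRel G.Adj] {k : ℕ}

/-- Union bound over the `(2k)^n` words of length `n` that may be too rare and the `2k` letters that
may be too frequent. -/
theorem card_not_isEquidistributed_le (hk : 0 < k) [Nonempty G.Dart] {σ : Equiv.Perm G.Dart}
    (hσ : ∀ e, (σ e).fst = e.snd ∧ σ e ≠ e.symm) {n : ℕ} (hn : 0 < n)
    (hgirth : (n : ℕ∞) < G.egirth) :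
    (Nat.card {α : Labelling G k // ¬ α.IsEquidistributed σ n} : ℝ) ≤
      ((2 * k : ℝ) ^ n + 2 * k) * Real.exp (-(1 / (8 * n ^ 2 * (2 * k : ℝ) ^ (2 * n))) *
        Nat.card G.edgeSet) * Nat.card (Labelling G k) := by
  classical
  obtain ⟨E, π, hE⟩ := exists_labelling_equiv G k
  have : Nonempty (Fin k × Bool) := ⟨(⟨0, hk⟩, true)⟩
  have : Nonempty G.edgeSet := by
    obtain ⟨e⟩ := ‹Nonempty G.Dart›
    exact ⟨⟨e.edge, e.edge_mem⟩⟩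
  have hq : (Fintype.card (Fin k × Bool) : ℝ) = 2 * k := by
    simp [mul_comm]
  have hk' : (1 : ℝ) ≤ k := by exact_mod_cast hk
  have hn' : (1 : ℝ) ≤ n := by exact_mod_cast hn
  have hD : Fintype.card G.Dart = 2 * Fintype.card G.edgeSet := by
    rw [G.dart_card_eq_twice_card_edges, SimpleGraph.edgeFinset_card]
  set j : ∀ m : ℕ, G.Dart → Fin m → G.edgeSet := fun m e i =>
    ⟨(σ^[i] e).edge, (σ^[i] e).edge_mem⟩ with hj
  set ϖ : ∀ m : ℕ, G.Dart → Fin m → Equiv.Perm (Fin k × Bool) := fun m e i => π (σ^[i] e) with hϖ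
  have hcount : ∀ (α : Labelling G k) (m : ℕ) (w : Fin m → Fin k × Bool),
      (Nat.card {e // α.pathWord σ m e = w} : ℝ) = matchCount (j m) (ϖ m) w (E α) := by
    intro α m w
    have : ∀ e, α.pathWord σ m e = fun i => ϖ m e i (E α (j m e i)) := fun e =>
      funext fun i => hE α _
    simp only [this, matchCount]
  have hinj : ∀ m ≤ n, ∀ e, Function.Injective (j m e) := fun m hm e i i' h =>
    injective_edge_iterate (fun e => (hσ e).1) (fun e => (hσ e).2)
      (lt_of_le_of_lt (by exact_mod_cast hm) hgirth) e (congrArg Subtype.val h)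
  have hl : ∀ m x i, Nat.card {e // j m e i = x} ≤ 2 := fun m x i => card_edge_fiber_le σ x i
  set X := Real.exp (-(1 / (8 * n ^ 2 * (2 * k : ℝ) ^ (2 * n))) * Nat.card G.edgeSet) with hX
  set C : ℝ := (Nat.card (Labelling G k) : ℝ) with hC
  have hCE : (Fintype.card (G.edgeSet → Fin k × Bool) : ℝ) = C := by
    rw [hC, Nat.card_congr E, Nat.card_eq_fintype_card]
  set low : (Fin n → Fin k × Bool) → Finset (G.edgeSet → Fin k × Bool) := fun w =>
    Finset.univ.filter fun g => matchCount (j n) (ϖ n) w g ≤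
      1 / 2 * (Fintype.card G.Dart / (Fintype.card (Fin k × Bool) : ℝ) ^ n) with hlow
  set high : (Fin 1 → Fin k × Bool) → Finset (G.edgeSet → Fin k × Bool) := fun w =>
    Finset.univ.filter fun g => 3 / 2 * (Fintype.card G.Dart /
      (Fintype.card (Fin k × Bool) : ℝ) ^ 1) ≤ matchCount (j 1) (ϖ 1) w g with hhigh
  have hlow_card : ∀ w, ((low w).card : ℝ) ≤ C * X := by
    intro w
    have h := (card_matchCount_deviation_le (π := ϖ n) (w := w) hn (hinj n le_rfl) (hl n) hD).2
    rw [hq, hCE, ← Nat.card_eq_fintype_card (α := G.edgeSet)] at h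
    simp only [hlow, hq]
    exact h
  have hhigh_card : ∀ w, ((high w).card : ℝ) ≤ C * X := by
    intro w
    have h := (card_matchCount_deviation_le (π := ϖ 1) (w := w) one_pos (hinj 1 hn) (hl 1) hD).1
    rw [hq, hCE, ← Nat.card_eq_fintype_card (α := G.edgeSet)] at h
    simp only [hhigh, hq]
    refine h.trans (mul_le_mul_of_nonneg_left (Real.exp_le_exp.2 ?_) (by positivity))
    rw [neg_mul, neg_mul, neg_le_neg_iff]
    -- Single letters concentrate at least as well as words of length `n`, so the rate for `n`
    -- serves for both.
    have h1 : (8 * ((1 : ℕ) : ℝ) ^ 2 * (2 * k : ℝ) ^ (2 * 1)) ≤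
        8 * n ^ 2 * (2 * k : ℝ) ^ (2 * n) := by
      have h2 : ((1 : ℕ) : ℝ) ^ 2 ≤ (n : ℝ) ^ 2 := by
        rw [Nat.cast_one]; gcongr
      have h3 : (2 * k : ℝ) ^ (2 * 1) ≤ (2 * k : ℝ) ^ (2 * n) :=
        pow_le_pow_right₀ (by linarith) (by omega)
      gcongr
    gcongr
  have hbad : (Nat.card {α : Labelling G k // ¬ α.IsEquidistributed σ n}) ≤
      (Finset.univ.biUnion low ∪ Finset.univ.biUnion high).card := by
    set U := Finset.univ.biUnion low ∪ Finset.univ.biUnion high with hU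
    refine le_of_le_of_eq (Nat.card_le_card_of_injective (β := U) (fun α => ⟨E α.1, ?_⟩)
      fun α β h => ?_) (Nat.card_eq_fintype_card.trans (Fintype.card_coe U))
    · by_contra hcon
      refine α.2 ⟨fun w => ?_, fun w => ?_⟩
      · by_contra! h
        refine hcon (Finset.mem_union_right _ (Finset.mem_biUnion.2 ⟨w, Finset.mem_univ _,
          Finset.mem_filter.2 ⟨Finset.mem_univ _, ?_⟩⟩))
        rw [← hcount, hq, ← Nat.card_eq_fintype_card]
        exact h.le
      · by_contra! h
        refine hcon (Finset.mem_union_left _ (Finset.mem_biUnion.2 ⟨w, Finset.mem_univ _,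
          Finset.mem_filter.2 ⟨Finset.mem_univ _, ?_⟩⟩))
        rw [← hcount, hq, ← Nat.card_eq_fintype_card]
        exact h.le
    · exact Subtype.ext (E.injective (congrArg Subtype.val h))
  have hU : ∀ (m : ℕ) (s : (Fin m → Fin k × Bool) → Finset (G.edgeSet → Fin k × Bool)),
      (∀ w, ((s w).card : ℝ) ≤ C * X) →
      ((Finset.univ.biUnion s).card : ℝ) ≤ (2 * k : ℝ) ^ m * (C * X) := by
    intro m s hs
    calc ((Finset.univ.biUnion s).card : ℝ) ≤ ∑ w, ((s w).card : ℝ) := by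
          exact_mod_cast Finset.card_biUnion_le
      _ ≤ ∑ _w : Fin m → Fin k × Bool, C * X := Finset.sum_le_sum fun w _ => hs w
      _ = (2 * k : ℝ) ^ m * (C * X) := by
          rw [Finset.sum_const, nsmul_eq_mul, Finset.card_univ, Fintype.card_fun, Fintype.card_fin]
          push_cast
          rw [hq]
  have h1 := hU n low hlow_card
  have h2 := hU 1 high hhigh_card
  have h3 : ((Finset.univ.biUnion low ∪ Finset.univ.biUnion high).card : ℝ) ≤
      (Finset.univ.biUnion low).card + (Finset.univ.biUnion high).card := by
    exact_mod_cast Finset.card_union_le _ _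
  have h4 : (Nat.card {α : Labelling G k // ¬ α.IsEquidistributed σ n} : ℝ) ≤
      ((Finset.univ.biUnion low ∪ Finset.univ.biUnion high).card : ℝ) := by exact_mod_cast hbad
  rw [pow_one] at h2
  linarith

end Equidistribution

/-! ### Actions of the group of a labelling -/

section Action

variable {V : Type*} {G : SimpleGraph V} {k : ℕ} (α : Labelling G k)

theorem Labelling.word_nil (u : V) : α.word (.nil : G.Walk u u) = 1 := by
  simp [Labelling.word]

theorem Labelling.word_cons {u v w : V} (h : G.Adj u v) (c : G.Walk v w) :
    α.word (.cons h c) = FreeGroup.mk [α.1 ⟨(u, v), h⟩] * α.word c := by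
  simp [Labelling.word]

theorem Labelling.word_append {u v w : V} (c : G.Walk u v) (d : G.Walk v w) :
    α.word (c.append d) = α.word c * α.word d := by
  simp [Labelling.word]

theorem mk_invLetter (s : Fin k × Bool) :
    FreeGroup.mk [invLetter s] = (FreeGroup.mk [s])⁻¹ := by
  simp [FreeGroup.inv_mk, FreeGroup.invRev, invLetter_apply]

theorem Labelling.word_reverse {u v : V} (c : G.Walk u v) :
    α.word c.reverse = (α.word c)⁻¹ := by
  induction c with
  | nil => simp [Labelling.word_nil]
  | @cons u v w h c ih =>
    rw [SimpleGraph.Walk.reverse_cons, α.word_append, ih, α.word_cons, α.word_cons, α.word_nil,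
      mul_one, mul_inv_rev, ← mk_invLetter]
    congr 3
    exact α.2 ⟨(u, v), h⟩

theorem Labelling.mk_word_eq_one {u : V} (c : G.Walk u u) :
    PresentedGroup.mk α.relators (α.word c) = 1 :=
  PresentedGroup.one_of_mem ⟨u, c, rfl⟩

/-- Labels of closed paths die in the quotient, so the image of a path label depends only on the two
ends. -/
theorem Labelling.mk_word_mul {u v w : V} (c : G.Walk u v) (d : G.Walk v w) (c' : G.Walk u w) :
    PresentedGroup.mk α.relators (α.word c) * PresentedGroup.mk α.relators (α.word d) =
      PresentedGroup.mk α.relators (α.word c') := by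
  have h := α.mk_word_eq_one ((c.append d).append c'.reverse)
  rw [α.word_append, α.word_append, α.word_reverse, map_mul, map_mul, map_inv,
    mul_inv_eq_one] at h
  exact h

variable {α} {Y : Type*} [MetricSpace Y]

/-- The isometry by which a letter acts. -/
def letterAction (ρ : α.group →* (Y ≃ᵢ Y)) (s : Fin k × Bool) : Y ≃ᵢ Y :=
  ρ (PresentedGroup.mk α.relators (FreeGroup.mk [s]))

theorem letterAction_invLetter (ρ : α.group →* (Y ≃ᵢ Y)) (s : Fin k × Bool) :
    letterAction ρ (invLetter s) = (letterAction ρ s)⁻¹ := by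
  rw [letterAction, mk_invLetter, map_inv, map_inv, letterAction]

theorem apply_eq_of_letterAction {ρ : α.group →* (Y ≃ᵢ Y)} {y : Y}
    (h : ∀ s, letterAction ρ s y = y) (g : α.group) : ρ g y = y := by
  obtain ⟨x, rfl⟩ := PresentedGroup.mk_surjective α.relators g
  induction x using FreeGroup.induction_on with
  | C1 => simp
  | of i => exact h (i, true)
  | inv_of i _ => exact mk_invLetter (i, true) ▸ h (invLetter (i, true))
  | mul x x' hx hx' => rw [map_mul, map_mul, IsometryEquiv.mul_apply, hx', hx]

/-- An orbit of the group of a labelling defines a map from the vertices of the graph. -/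
theorem exists_orbit_map (hG : G.Connected) (ρ : α.group →* (Y ≃ᵢ Y)) (y : Y) :
    ∃ φ : V → Y, ∀ (u v : V) (c : G.Walk u v),
      dist (φ u) (φ v) = dist (ρ (PresentedGroup.mk α.relators (α.word c)) y) y := by
  obtain ⟨v₀⟩ := hG.nonempty
  have p : ∀ v, G.Walk v₀ v := fun v => (hG.preconnected v₀ v).some
  -- The vertex `v` goes to the translate of `y` by the label of any path from the base vertex `v₀`.
  refine ⟨fun v => ρ (PresentedGroup.mk α.relators (α.word (p v))) y, fun u v c => ?_⟩
  change dist (ρ _ y) (ρ _ y) = _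
  rw [← α.mk_word_mul (p u) c (p v), map_mul, IsometryEquiv.mul_apply, IsometryEquiv.dist_eq,
    dist_comm]

theorem map_word_eq_wordProd (ρ : α.group →* (Y ≃ᵢ Y)) {u v : V} (c : G.Walk u v)
    {σ : G.Dart → G.Dart} {m : ℕ} {e : G.Dart} (hc : c.darts = List.ofFn fun i : Fin m => σ^[i] e) :
    ρ (PresentedGroup.mk α.relators (α.word c)) =
      wordProd (letterAction ρ) (α.pathWord σ m e) := by
  rw [Labelling.word, hc, List.map_ofFn, map_list_prod, map_list_prod, List.map_ofFn,
    List.map_ofFn]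
  rfl

end Action

/-! ### From equidistribution to fixed points -/

section FixedPoint

variable {V : Type*} [Fintype V] {G : SimpleGraph V} [DecidableRel G.Adj] {k : ℕ}
  {α : Labelling G k} {Y : Type*} [MetricSpace Y]

theorem sum_pathWord (α : Labelling G k) (σ : G.Dart → G.Dart) (m : ℕ)
    (F : (Fin m → Fin k × Bool) → ℝ) :
    ∑ e, F (α.pathWord σ m e) = ∑ w, (Nat.card {e // α.pathWord σ m e = w} : ℝ) * F w := by
  classical
  rw [← Finset.sum_fiberwise Finset.univ (α.pathWord σ m)]
  refine Finset.sum_congr rfl fun w _ => ?_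
  rw [Nat.card_eq_fintype_card, Fintype.card_subtype, ← nsmul_eq_mul, ← Finset.sum_const]
  exact Finset.sum_congr rfl fun e he => by rw [(Finset.mem_filter.1 he).2]

/-- Equidistribution and the Poincaré inequality bound the `n`-step energy of an orbit. -/
theorem wordEnergy_le_of_isEquidistributed [CompleteSpace Y] (hY : IsCAT0 Y)
    (hG : G.Connected) (hk : 0 < k) [Nonempty G.Dart] {lam : ℝ} (hlam : 0 < lam)
    (hwang : ∀ p : Y, ENNReal.ofReal lam ≤ wangInvariant G (TangentCone p))
    {σ : Equiv.Perm G.Dart} (hσ : ∀ e, (σ e).fst = e.snd) {n : ℕ}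
    (hα : α.IsEquidistributed σ n) (ρ : α.group →* (Y ≃ᵢ Y)) (y : Y) :
    wordEnergy (letterAction ρ) n y ≤ 8 / lam * letterEnergy (letterAction ρ) y := by
  have : Nonempty Y := ⟨y⟩
  have hk' : (0 : ℝ) < k := by exact_mod_cast hk
  have hq : (Fintype.card (Fin k × Bool) : ℝ) = 2 * k := by simp [mul_comm]
  set T := letterAction ρ with hT
  set N : ℝ := (Fintype.card G.Dart : ℝ) with hN
  have hN0 : 0 < N := by rw [hN]; exact_mod_cast Fintype.card_pos
  have hNat : (Nat.card G.Dart : ℝ) = N := by rw [Nat.card_eq_fintype_card]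
  obtain ⟨φ, hφ⟩ := exists_orbit_map hG ρ y
  have hpath : ∀ m e, dist (φ e.fst) (φ (σ^[m] e).fst) =
      dist (wordProd T (α.pathWord σ m e) y) y := by
    intro m e
    obtain ⟨c, hc⟩ := exists_walk_darts_eq_ofFn hσ m e
    rw [hφ _ _ c, map_word_eq_wordProd ρ c hc]
  obtain ⟨b, hb⟩ := hY.exists_isBarycenter (vertexMeasure_nonneg G) sum_vertexMeasure φ
  have hP := hY.poincare G hb (hwang b)
  rw [sum_vertexMeasure_mul (fun u => dist (φ u) b ^ 2),
    sum_vertexMeasure_randomWalk (fun u v => dist (φ u) (φ v) ^ 2)] at hP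
  set A := ∑ e : G.Dart, dist (φ e.fst) b ^ 2 with hA
  have hletter : ∑ e : G.Dart, dist (φ e.fst) (φ e.snd) ^ 2 ≤ 3 / 2 * N * letterEnergy T y := by
    have h1 : ∑ e : G.Dart, dist (φ e.fst) (φ e.snd) ^ 2 =
        ∑ e : G.Dart, dist (wordProd T (α.pathWord σ 1 e) y) y ^ 2 :=
      Finset.sum_congr rfl fun e _ => by rw [← hpath, Function.iterate_one, hσ]
    have h2 : ∑ w : Fin 1 → Fin k × Bool, dist (wordProd T w y) y ^ 2 =
        2 * k * letterEnergy T y := by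
      rw [letterEnergy, hq, Finset.mul_sum, ← (Equiv.funUnique (Fin 1) (Fin k × Bool)).sum_comp]
      refine Finset.sum_congr rfl fun w _ => ?_
      rw [← mul_assoc, mul_inv_cancel₀ (by positivity), one_mul]
      simp [wordProd]
    rw [h1, sum_pathWord α σ 1 fun w => dist (wordProd T w y) y ^ 2]
    refine (Finset.sum_le_sum fun w _ => mul_le_mul_of_nonneg_right (hα.letter_le w)
      (sq_nonneg _)).trans_eq ?_
    rw [← Finset.mul_sum, h2, hNat]
    field_simp
  have hword : 1 / 2 * N * wordEnergy T n y ≤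
      ∑ e : G.Dart, dist (φ e.fst) (φ (σ^[n] e).fst) ^ 2 := by
    simp only [hpath]
    rw [sum_pathWord α σ n fun w => dist (wordProd T w y) y ^ 2]
    refine le_of_eq_of_le ?_ (Finset.sum_le_sum fun w _ =>
      mul_le_mul_of_nonneg_right (hα.le_word w) (sq_nonneg _))
    rw [← Finset.mul_sum, hNat, wordEnergy, hq]
    ring
  -- Since `σ ^ n` is a permutation, the ends of the paths have the same distribution as their
  -- origins.
  have hend : ∑ e : G.Dart, dist (φ (σ^[n] e).fst) b ^ 2 = A := by
    rw [hA, ← Equiv.sum_comp (σ ^ n) fun e : G.Dart => dist (φ e.fst) b ^ 2,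
      Equiv.Perm.iterate_eq_pow]
  have hupper : ∑ e : G.Dart, dist (φ e.fst) (φ (σ^[n] e).fst) ^ 2 ≤ 4 * A := by
    have h1 : ∀ e : G.Dart, dist (φ e.fst) (φ (σ^[n] e).fst) ^ 2 ≤
        2 * dist (φ e.fst) b ^ 2 + 2 * dist (φ (σ^[n] e).fst) b ^ 2 := by
      intro e
      have h2 := dist_triangle_right (φ e.fst) (φ (σ^[n] e).fst) b
      have h3 : dist (φ e.fst) (φ (σ^[n] e).fst) ^ 2 ≤
        (dist (φ e.fst) b + dist (φ (σ^[n] e).fst) b) ^ 2 := by gcongr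
      nlinarith [sq_nonneg (dist (φ e.fst) b - dist (φ (σ^[n] e).fst) b)]
    refine (Finset.sum_le_sum fun e _ => h1 e).trans_eq ?_
    rw [Finset.sum_add_distrib, ← Finset.mul_sum, ← Finset.mul_sum, hend]
    ring
  have hPA : lam * A ≤ 3 / 4 * N * letterEnergy T y := by
    rw [← mul_div_assoc, ← mul_div_assoc, div_le_div_iff_of_pos_right hN0] at hP
    linarith
  have he := letterEnergy_nonneg T y
  -- The factors `2`, `4` and `3 / 4` multiply to `6`, which is rounded up to `8`.
  have h1 : lam * (N * wordEnergy T n y) ≤ 8 * N * letterEnergy T y := by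
    have : lam * (1 / 2 * N * wordEnergy T n y) ≤ lam * (4 * A) :=
      mul_le_mul_of_nonneg_left (hword.trans hupper) hlam.le
    have : 0 ≤ N * letterEnergy T y := mul_nonneg hN0.le he
    linarith
  rw [div_mul_eq_mul_div, le_div_iff₀ hlam]
  have h2 : N * (wordEnergy T n y * lam) ≤ N * (8 * letterEnergy T y) := by linarith
  exact le_of_mul_le_mul_left h2 hN0

theorem hasFixedPointProperty_of_isEquidistributed [CompleteSpace Y] [Nonempty Y] (hY : IsCAT0 Y)
    (hG : G.Connected) (hk : 0 < k) [Nonempty G.Dart] {lam : ℝ} (hlam : 0 < lam)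
    (hwang : ∀ p : Y, ENNReal.ofReal lam ≤ wangInvariant G (TangentCone p))
    {σ : Equiv.Perm G.Dart} (hσ : ∀ e, (σ e).fst = e.snd) {n : ℕ} (hn : 0 < n)
    (hnlam : 8 / lam ≤ n - 1) (hα : α.IsEquidistributed σ n) :
    HasFixedPointProperty α.group Y := by
  intro ρ
  have : Nonempty (Fin k × Bool) := ⟨(⟨0, hk⟩, true)⟩
  obtain ⟨y, hy⟩ := hY.exists_fixed_of_wordEnergy_le (T := letterAction ρ) invLetter
    (letterAction_invLetter ρ) hn fun y =>
      (wordEnergy_le_of_isEquidistributed hY hG hk hlam hwang hσ hα ρ y).trans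
        (mul_le_mul_of_nonneg_right hnlam (letterEnergy_nonneg _ _))
  exact ⟨y, apply_eq_of_letterAction hy⟩

end FixedPoint

end GraphModel

end

theorem mainTheorem4 (lam : ℝ) (hlam : 0 < lam) :
    ∃ g₀ : ℕ, ∀ k : ℕ, 0 < k →
    ∃ a₁ : ℝ, 0 < a₁ ∧ ∀ d₀ : ℕ, 0 < d₀ →
    ∃ a₂ : ℝ, 0 < a₂ ∧
      ∀ (V : Type*) [Fintype V] (G : SimpleGraph V) [DecidableRel G.Adj],
        G.Connected →
        (∀ x : V, 2 ≤ G.degree x ∧ G.degree x ≤ d₀) →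
        (g₀ : ℕ∞) ≤ G.egirth →
      ∀ (ι : Type*) (Y : ι → Type*) [∀ i, MetricSpace (Y i)] [∀ i, CompleteSpace (Y i)]
        [∀ i, Nonempty (Y i)],
        (∀ i, GraphModel.IsCAT0 (Y i)) →
        (∀ i, ∀ p : Y i,
          ENNReal.ofReal lam ≤ GraphModel.wangInvariant G (GraphModel.TangentCone p)) →
        1 - a₁ * Real.exp (-a₂ * (Fintype.card V : ℝ)) ≤
          GraphModel.labellingProb G k
            (fun α => ∀ i, GraphModel.HasFixedPointProperty α.group (Y i)) := by
  -- The path length `n = N + 1` satisfies `8 / lam ≤ n - 1`; girth at least `n + 1` makes paths of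
  -- length `n` free of repeated edges.
  obtain ⟨N, hN⟩ := exists_nat_ge (8 / lam)
  set n := N + 1 with hn
  have hn0 : 0 < n := Nat.succ_pos N
  have hn0' : (0 : ℝ) < n := by exact_mod_cast hn0
  refine ⟨n + 1, fun k hk => ?_⟩
  have hk' : (0 : ℝ) < k := by exact_mod_cast hk
  -- `a₁` counts the events in the union bound and `a₂` is the concentration rate per edge.
  refine ⟨(2 * k : ℝ) ^ n + 2 * k, by positivity, fun d₀ _ =>
    ⟨1 / (8 * n ^ 2 * (2 * k : ℝ) ^ (2 * n)), by positivity, ?_⟩⟩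
  intro V _ G _ hG hdeg hgirth ι Y _ _ _ hY hwang
  classical
  have hD : Nonempty G.Dart := by
    obtain ⟨v⟩ := hG.nonempty
    obtain ⟨u, hu⟩ := (G.degree_pos_iff_exists_adj v).1 (by have := (hdeg v).1; omega)
    exact ⟨⟨(v, u), hu⟩⟩
  have hgirth' : (n : ℕ∞) < G.egirth :=
    lt_of_lt_of_le (by exact_mod_cast Nat.lt_succ_self n) hgirth
  obtain ⟨σ, hσ⟩ := GraphModel.exists_dart_perm fun v => (hdeg v).1
  obtain ⟨E, -, -⟩ := GraphModel.exists_labelling_equiv G k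
  have : Finite (GraphModel.Labelling G k) := Finite.of_equiv _ E.symm
  have : Nonempty (GraphModel.Labelling G k) := ⟨E.symm fun _ => (⟨0, hk⟩, true)⟩
  -- Degrees at least `2` give at least as many edges as vertices, so decay in the number of edges
  -- becomes decay in the number of vertices.
  have hcard : (Fintype.card V : ℝ) ≤ Nat.card G.edgeSet := by
    have h1 := G.sum_degrees_eq_twice_card_edges
    have h2 : Fintype.card V * 2 ≤ ∑ v, G.degree v := by
      rw [← Finset.card_univ, ← smul_eq_mul]
      exact Finset.card_nsmul_le_sum _ _ _ fun v _ => (hdeg v).1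
    rw [h1, SimpleGraph.edgeFinset_card, ← Nat.card_eq_fintype_card (α := G.edgeSet)] at h2
    exact_mod_cast (by omega : Fintype.card V ≤ Nat.card G.edgeSet)
  refine GraphModel.labellingProb_ge ?_
  -- Equidistribution does not refer to the spaces, so a single bad set covers the whole family,
  -- however large.
  have hsub : Nat.card {α : GraphModel.Labelling G k //
      ¬ ∀ i, GraphModel.HasFixedPointProperty α.group (Y i)} ≤
      Nat.card {α : GraphModel.Labelling G k // ¬ α.IsEquidistributed σ n} := by
    refine Nat.card_le_card_of_injective (fun α => ⟨α.1, fun hα => α.2 fun i => ?_⟩)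
      fun α β h => Subtype.ext (Subtype.mk.inj h)
    exact GraphModel.hasFixedPointProperty_of_isEquidistributed (hY i) hG hk hlam (hwang i)
      (fun e => (hσ e).1) hn0 (by rw [hn]; push_cast; linarith) hα
  refine (Nat.cast_le.2 hsub).trans
    ((GraphModel.card_not_isEquidistributed_le hk hσ hn0 hgirth').trans ?_)
  refine mul_le_mul_of_nonneg_right (mul_le_mul_of_nonneg_left (Real.exp_le_exp.2 ?_)
    (by positivity)) (by positivity)
  rw [neg_mul, neg_mul, neg_le_neg_iff]
  exact mul_le_mul_of_nonneg_left hcard (by positivity)
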